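/- Let $\mathcal S$ be a finite poset whose Hasse diagram (an undirected graph on the set $S$) is connected. A finite poset is *acyclic* if its Hasse diagram has no cycle, and *non-acyclic* otherwise. $\mathcal S$ *has an acyclic extension* if it is (isomorphic to) an induced subposet of some finite connected acyclic poset. A poset is in *Y-class* if it is acyclic and has no induced bowtie, that is, no elements $e,f,g,h$ with $e,f<g,h$, with $e,f$ incomparable and $g,h$ incomparable. **Monotonicity.** A generator on a finite set $E$ is a real matrix $L$ on $E\times E$ with $L(x,y)\ge 0$ for $x\ne y$ and $\sum_{y}L(x,y)=0$ for every $x$; its transition probability $P_t=e^{tL}$, $t\ge 0$, is the solution of $\frac{d}{dt}P_t=P_tL$, $P_0=I$. For a generator $L$ on $S$, $P_t$ is *stochastically monotone* if $\sum_{z\in U}P_t(x,z)\le\sum_{z\in U}P_t(y,z)$ for all $t\ge0$, all $x\le y$ and all up-sets $U$ of $\mathcal S$. It is *realizably monotone* if there is a continuous-time Markov process $\xi_t$ (given by a generator) on the set of monotone maps $\mathcal S\to\mathcal S$, started at $\xi_0=\mathrm{id}$, with $\mathbb P(\xi_t(x)=y)=P_t(x,y)$ for all $t\ge 0$ and $x,y\in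 S$. *Monotonicity equivalence* holds for continuous-time Markov processes on $\mathcal S$ if for every generator $L$ on $S$ the process is stochastically monotone if and only if it is realizably monotone. **Y-glued bipartite posets.** A *bipartite subgraph* $A$ of the Hasse diagram consists of a set of at least two lower vertices $a_1,\dots,a_m$ and a set of at least two upper vertices $b_1,\dots,b_n$ of $S$ such that every $b_j$ covers every $a_i$; it is *maximal* if it is not properly contained in another one. For such $A$, let $\hat{\mathcal S}$ be the poset on $S\cup\{c\}$, with $c$ a new element, in which $\mathcal S$ is an induced subposet, $x\le c$ if and only if $x=c$ or $x\le a_i$ for some $i$, and $c\le y$ if and only if $y=c$ or $b_j\le y$ for some $j$ (so in the Hasse diagram the edges $(a_i,b_j)$ are replaced by the edges $(a_i,c)$ and $(c,b_j)$). Let $\mathcal S_1$ (respectively $\mathcal S_2$) be the induced subposet of $\hat{\mathcal S}$ consisting of $c$ and of all vertices that are joined to some $a_i$ (respectively to some $b_j$) by a path in the Hasse diagram of $\hat{\mathcal S}$ that avoids $c$. Then $\mathcal S$ is *Y-glued bipartite* if (a) it is non-acyclic and has an acyclic extension, (b) it has exactly one maximal bipartite subgraph $A$, and (c) for this $A$ both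 $\mathcal S_1$ and $\mathcal S_2$ are in Y-class. **Proposition 2.3.** Suppose that $\mathcal S$ is non-acyclic and has an acyclic extension. Then monotonicity equivalence holds for continuous-time Markov processes on $\mathcal S$ if and only if $\mathcal S$ is a Y-glued bipartite poset. -/

import Mathlib

/-! ## Poset classes

Hasse diagrams are undirected graphs (`SimpleGraph.hasse`). -/

/-- A poset is acyclic if its Hasse diagram, as an undirected graph, has no cycle. -/
def AcyclicPoset (S : Type*) [PartialOrder S] : Prop :=
  (SimpleGraph.hasse S).IsAcyclic

/-- `S` is (isomorphic to) an induced subposet of some finite connected acyclic poset. -/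
def HasAcyclicExtension.{u} (S : Type u) [PartialOrder S] : Prop :=
  ∃ (T : Type u) (_ : PartialOrder T), Finite T ∧ (SimpleGraph.hasse T).Connected ∧
    AcyclicPoset T ∧ Nonempty (S ↪o T)

/-- `S` has the bowtie as an induced subposet: minimal elements `e`, `f` and maximal
elements `g`, `h` of the bowtie. -/
def HasInducedBowtie (S : Type*) [PartialOrder S] : Prop :=
  ∃ e f g h : S, e < g ∧ e < h ∧ f < g ∧ f < h ∧
    ¬ e ≤ f ∧ ¬ f ≤ e ∧ ¬ g ≤ h ∧ ¬ h ≤ g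

/-- Y-class: acyclic and without an induced bowtie. -/
def YClass (S : Type*) [PartialOrder S] : Prop :=
  AcyclicPoset S ∧ ¬ HasInducedBowtie S

/-! ## Complete bipartite subgraphs of the Hasse diagram and the extension by a vertex -/

/-- A complete bipartite subgraph of the Hasse diagram of `S` with at least two lower vertices
`a_i` and at least two upper vertices `b_j`, every `b_j` covering every `a_i`. The `a_i` are then
pairwise incomparable, and so are the `b_j`, so that the induced subposet is `(m,n)`-bipartite. -/
@[ext]
structure BipartiteSub (S : Type*) [PartialOrder S] where
  lower : Set S
  upper : Set S
  lower_nontrivial : lower.Nontrivial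
  upper_nontrivial : upper.Nontrivial
  covBy : ∀ a ∈ lower, ∀ b ∈ upper, a ⋖ b

namespace BipartiteSub

/-- Maximality with respect to inclusion of subgraphs. -/
def IsMaximal {S : Type*} [PartialOrder S] (A : BipartiteSub S) : Prop :=
  ∀ B : BipartiteSub S, A.lower ⊆ B.lower → A.upper ⊆ B.upper → B = A

/-- The vertices of the extension of `S`: those of `S` and a new vertex `center`. -/
inductive Extension {S : Type*} [PartialOrder S] (A : BipartiteSub S)
  | center : Extension A
  | vertex (x : S) : Extension A

open Extension

/-- The order of the extension: that of `S`, with `center` inserted between the lower and the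
upper vertices of `A`. In its Hasse diagram the edges between lower and upper vertices of `A` are
replaced by edges from the lower vertices to `center` and from `center` to the upper vertices. -/
def extLE {S : Type*} [PartialOrder S] (A : BipartiteSub S) : A.Extension → A.Extension → Prop
  | center, center => True
  | vertex x, center => ∃ a ∈ A.lower, x ≤ a
  | center, vertex y => ∃ b ∈ A.upper, b ≤ y
  | vertex x, vertex y => x ≤ y

instance instPartialOrderExtension {S : Type*} [PartialOrder S] (A : BipartiteSub S) :
    PartialOrder A.Extension where
  le := A.extLE
  le_refl u := by cases u <;> simp [extLE]
  le_trans u v w huv hvw := by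
    cases u <;> cases v <;> cases w <;> simp only [extLE] at huv hvw ⊢
    · exact hvw
    · obtain ⟨b, hb, h⟩ := huv
      exact ⟨b, hb, h.trans hvw⟩
    · exact huv
    · obtain ⟨a, ha, h⟩ := huv
      obtain ⟨b, hb, h'⟩ := hvw
      exact h.trans ((A.covBy a ha b hb).le.trans h')
    · obtain ⟨a, ha, h⟩ := hvw
      exact ⟨a, ha, huv.trans h⟩
    · exact huv.trans hvw
  le_antisymm u v huv hvu := by
    cases u <;> cases v <;> simp only [extLE] at huv hvu
    · rfl
    · obtain ⟨b, hb, h⟩ := huv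
      obtain ⟨a, ha, h'⟩ := hvu
      exact absurd (h.trans h') (A.covBy a ha b hb).lt.not_ge
    · obtain ⟨a, ha, h⟩ := huv
      obtain ⟨b, hb, h'⟩ := hvu
      exact absurd (h'.trans h) (A.covBy a ha b hb).lt.not_ge
    · exact congrArg vertex (le_antisymm huv hvu)

/-- The vertices equal to `center` or connected to `center` via some lower vertex `a` of `A`
in the Hasse diagram of the extension (the part of the path before the edge from `a` to `center`
does not visit `center`). -/
def lowerPiece {S : Type*} [PartialOrder S] (A : BipartiteSub S) : Set A.Extension :=
  {v | v = center ∨ ∃ a ∈ A.lower, ∃ w : (SimpleGraph.hasse A.Extension).Walk v (vertex a),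
    center ∉ w.support}

/-- The vertices equal to `center` or connected to `center` via some upper vertex of `A`. -/
def upperPiece {S : Type*} [PartialOrder S] (A : BipartiteSub S) : Set A.Extension :=
  {v | v = center ∨ ∃ b ∈ A.upper, ∃ w : (SimpleGraph.hasse A.Extension).Walk v (vertex b),
    center ∉ w.support}

end BipartiteSub

/-- Y-glued bipartite posets. -/
def IsYGluedBipartite (S : Type*) [PartialOrder S] : Prop :=
  ¬ AcyclicPoset S ∧ HasAcyclicExtension S ∧
    ∃ A : BipartiteSub S, A.IsMaximal ∧ (∀ B : BipartiteSub S, B.IsMaximal → B = A) ∧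
      YClass A.lowerPiece ∧ YClass A.upperPiece

/-! ## Continuous-time Markov processes on a finite state space -/

/-- Generators: nonnegative off-diagonal entries and vanishing row sums. -/
structure IsGenerator {E : Type*} [Fintype E] (L : Matrix E E ℝ) : Prop where
  nonneg : ∀ x y, x ≠ y → 0 ≤ L x y
  row_sum : ∀ x, ∑ y, L x y = 0

open scoped Classical in
/-- The transition probability `P_t = exp (t L)` of the Markov process with generator `L`, the
solution of the forward equation `d/dt P_t = P_t L` with `P_0 = 1`. -/
noncomputable def transition {E : Type*} [Fintype E] (L : Matrix E E ℝ) (t : ℝ) :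
    Matrix E E ℝ :=
  NormedSpace.exp (t • L)

open scoped Classical in
theorem transition_zero {E : Type*} [Fintype E] (L : Matrix E E ℝ) : transition L 0 = 1 := by
  simp [transition]

open scoped Classical in
/-- Kolmogorov's forward equation. -/
theorem hasDerivAt_transition {E : Type*} [Fintype E] (L : Matrix E E ℝ) (t : ℝ) (x y : E) :
    HasDerivAt (fun s => transition L s x y) (∑ z, transition L t x z * L z y) t := by
  let _ : NormedRing (Matrix E E ℝ) := Matrix.linftyOpNormedRing
  let _ : NormedAlgebra ℝ (Matrix E E ℝ) := Matrix.linftyOpNormedAlgebra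
  have h : HasDerivAt (fun s : ℝ => NormedSpace.exp (s • L)) (NormedSpace.exp (t • L) * L) t :=
    hasDerivAt_exp_smul_const L t
  have h2 : HasDerivAt (fun s : ℝ => NormedSpace.exp (s • L) x y)
      ((NormedSpace.exp (t • L) * L) x y) t :=
    (Matrix.entryLinearMap ℝ ℝ x y).toContinuousLinearMap.hasFDerivAt.comp_hasDerivAt t h
  rw [Matrix.mul_apply] at h2
  exact h2

open scoped Classical in
/-- `P_t(x, ·)` is stochastically smaller than `P_t(y, ·)` for all `t ≥ 0` and `x ≤ y`. -/
def StochasticallyMonotone {S : Type*} [Fintype S] [PartialOrder S]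
    (P : ℝ → Matrix S S ℝ) : Prop :=
  ∀ t : ℝ, 0 ≤ t → ∀ x y : S, x ≤ y → ∀ U : Set S, IsUpperSet U →
    (∑ z with z ∈ U, P t x z) ≤ ∑ z with z ∈ U, P t y z

noncomputable instance instFintypeOrderHomSelf {S : Type*} [Fintype S] [PartialOrder S] :
    Fintype (S →o S) :=
  @Fintype.ofFinite _ (DFunLike.finite (S →o S))

open scoped Classical in
/-- There is a continuous-time Markov process `ξ_t` on the space of monotone maps from `S` to
itself, with some generator `G`, such that, when started from `ξ_0 = id`,
the probability that `ξ_t(x) = y` is `P_t(x, y)`. -/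
def RealizablyMonotone {S : Type*} [Fintype S] [PartialOrder S]
    (P : ℝ → Matrix S S ℝ) : Prop :=
  ∃ G : Matrix (S →o S) (S →o S) ℝ, IsGenerator G ∧
    ∀ t : ℝ, 0 ≤ t → ∀ x y : S,
      ∑ h : S →o S with h x = y, transition G t OrderHom.id h = P t x y

/-- Stochastic and realizable monotonicity are equivalent for every continuous-time Markov
process on `S`. -/
def MonotonicityEquivalence (S : Type*) [Fintype S] [PartialOrder S] : Prop :=
  ∀ L : Matrix S S ℝ, IsGenerator L →
    (StochasticallyMonotone (transition L) ↔ RealizablyMonotone (transition L))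

/-!
By Kolmogorov's equations, `transition L` is realizably monotone if and only if the off-diagonal
rates of `L` are a superposition of jumps `z ↦ h z` with monotone maps `h`
(`RateRealizable`), and this always implies stochastic monotonicity. The question is thus when a
stochastically monotone generator `L` is a mixture of monotone maps.

In an acyclic poset each cover `u ⋖ v` has a cut (`IsCut`), an up-set that no other cover crosses.
Two consequences carry the positive direction. Stochastic ordering is decided on the cuts alone,
and a measure of given total mass is determined by its masses on the cuts (`eq_sum_mass_cut`,
`exists_isMonotoneCoupling_of_cut_le`). Couplings along the covers of an acyclic index poset can
be glued to a random monotone map (`exists_law_of_coupling`). A non-acyclic `S` lacks the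
second property, but if it is Y-glued bipartite, then the extension by `center` is acyclic. It
remains to find a row for `center` between the rows of the lower and those of the upper vertices.
Its mass on each cut is taken to be the largest mass of the lower rows or the smallest of the upper
ones, and the absence of bowties in the two pieces allows a choice for which the resulting signed
measure is nonnegative (`exists_interpolation`). The random monotone maps of the extension then
restrict to `S` (`BipartiteSub.rateRealizable_of_extension`).

Conversely, let `T` be an acyclic extension of `S` of least cardinality. Each of its new vertices
has at least two lower and two upper covers (`IsReducedExtension`), and there is at least one new
vertex `c`. The branches at `c` split `S` into classes on which the rows of a kernel can be
prescribed. If a branch contains another new vertex, or forms a bowtie with or without `c`, then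
rows with three targets each can be chosen that are stochastically monotone but not realizable:
three mutually exclusive jumps of rate one would all force the same row to use a rate of two
(`hasUnrealizableRows_of_classes`, `hasUnrealizableRows_of_branch`). Monotonicity equivalence
therefore implies that `c` is the only new vertex. Then `T` is the extension at the bipartite
subgraph formed by the maximal elements of `S` below `c` and the minimal ones above `c`
(`nonempty_extension_orderIso`), which is the unique maximal one, and the two pieces contain no
bowtie. If, on the other hand, `S` is Y-glued bipartite, the uniqueness of the maximal bipartite
subgraph again leaves only one new vertex in `T`, and the extension is acyclic.
-/

/-! ### Transition probabilities and rates of monotone maps -/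

section Transition

open scoped Classical Nat

variable {E : Type*} [Fintype E]

lemma hasSum_transition (L : Matrix E E ℝ) (t : ℝ) (x y : E) :
    HasSum (fun n : ℕ => (n ! : ℝ)⁻¹ * (t ^ n * (L ^ n) x y)) (transition L t x y) := by
  let _ : NormedRing (Matrix E E ℝ) := Matrix.linftyOpNormedRing
  let _ : NormedAlgebra ℝ (Matrix E E ℝ) := Matrix.linftyOpNormedAlgebra
  have h : HasSum (fun n : ℕ => ((n ! : ℝ)⁻¹) • (t • L) ^ n) (NormedSpace.exp (t • L)) :=
    NormedSpace.exp_series_hasSum_exp' (𝕂 := ℝ) (t • L)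
  have h2 := h.map (Matrix.entryLinearMap ℝ ℝ x y).toContinuousLinearMap
    (ContinuousLinearMap.continuous _)
  have h3 : (fun n : ℕ => (n ! : ℝ)⁻¹ * (t ^ n * (L ^ n) x y)) =
      (Matrix.entryLinearMap ℝ ℝ x y).toContinuousLinearMap ∘
        (fun n : ℕ => ((n ! : ℝ)⁻¹) • (t • L) ^ n) := by
    funext n
    simp [smul_pow]
  rw [h3]
  exact h2

lemma transition_add_smul_one (L : Matrix E E ℝ) (c t : ℝ) :
    transition (L + c • (1 : Matrix E E ℝ)) t = Real.exp (t * c) • transition L t := by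
  unfold transition
  rw [smul_add, Matrix.exp_add_of_commute]
  · have : t • c • (1 : Matrix E E ℝ) = Matrix.diagonal fun _ => t * c := by
      rw [smul_smul, Matrix.smul_one_eq_diagonal]
    rw [this, Matrix.exp_diagonal]
    have : (NormedSpace.exp fun _ : E => t * c) = fun _ => Real.exp (t * c) := by
      rw [Pi.exp_def, Real.exp_eq_exp_ℝ]
    rw [this]
    ext x y
    simp [Matrix.mul_diagonal, mul_comm]
  · rw [smul_smul]
    exact Commute.smul_right (Commute.one_right _) _

/-- The transition probabilities of a generator are nonnegative: its diagonal is made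
nonnegative by adding a multiple of the identity, which only rescales `transition`. -/
lemma IsGenerator.transition_nonneg {L : Matrix E E ℝ} (hL : IsGenerator L) {t : ℝ}
    (ht : 0 ≤ t) (x y : E) : 0 ≤ transition L t x y := by
  set c : ℝ := ∑ x, |L x x| with hc
  have hM : ∀ x y, 0 ≤ (L + c • (1 : Matrix E E ℝ)) x y := by
    intro x y
    by_cases hxy : x = y
    · subst hxy
      have h1 : |L x x| ≤ c :=
        Finset.single_le_sum (f := fun x => |L x x|) (fun i _ => abs_nonneg _) (Finset.mem_univ x)
      have h2 := neg_abs_le (L x x)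
      simp only [Matrix.add_apply, Matrix.smul_apply, Matrix.one_apply_eq, smul_eq_mul, mul_one]
      linarith
    · simpa [Matrix.one_apply_ne hxy] using hL.nonneg x y hxy
  have hpow : ∀ n : ℕ, ∀ x y, 0 ≤ ((L + c • (1 : Matrix E E ℝ)) ^ n) x y := by
    intro n
    induction n with
    | zero =>
      intro x y
      rw [pow_zero, Matrix.one_apply]
      split_ifs <;> norm_num
    | succ n ih =>
      intro x y
      rw [pow_succ, Matrix.mul_apply]
      exact Finset.sum_nonneg fun z _ => mul_nonneg (ih x z) (hM z y)
  have h := (hasSum_transition (L + c • (1 : Matrix E E ℝ)) t x y).nonneg fun n =>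
    mul_nonneg (by positivity) (mul_nonneg (pow_nonneg ht n) (hpow n x y))
  rw [transition_add_smul_one] at h
  exact nonneg_of_mul_nonneg_right h (Real.exp_pos _)

lemma hasDerivAt_transition_zero (L : Matrix E E ℝ) (x y : E) :
    HasDerivAt (fun s => transition L s x y) (L x y) 0 := by
  have h := hasDerivAt_transition L 0 x y
  rw [transition_zero] at h
  simpa [Matrix.one_apply] using h

end Transition

section Realizable

open scoped Classical

variable {S : Type*} [Fintype S] [PartialOrder S]

/-- The off-diagonal rates `q x y` are those of a superposition of monotone maps: jumps
`z ↦ h z`, one for each monotone map `h`, occur at rates `w h`. The rate of the identity is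
irrelevant. -/
def RateRealizable (q : S → S → ℝ) : Prop :=
  ∃ w : (S →o S) → ℝ, (∀ h, 0 ≤ w h) ∧
    ∀ x y, x ≠ y → ∑ h : S →o S, (if h x = y then w h else 0) = q x y

lemma RealizablyMonotone.rateRealizable {L : Matrix S S ℝ}
    (h : RealizablyMonotone (transition L)) : RateRealizable L := by
  obtain ⟨G, hG, hP⟩ := h
  refine ⟨fun h => if h = OrderHom.id then 0 else G OrderHom.id h, fun h => ?_,
    fun x y hxy => ?_⟩
  · dsimp only
    split_ifs with hh
    · exact le_rfl
    · exact hG.nonneg _ _ (Ne.symm hh)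
  · have h1 : HasDerivAt (fun s => ∑ h : S →o S with h x = y, transition G s OrderHom.id h)
        (∑ h : S →o S with h x = y, G OrderHom.id h) 0 :=
      HasDerivAt.fun_sum fun h _ => hasDerivAt_transition_zero G OrderHom.id h
    have h2 : HasDerivAt (fun s => transition L s x y) (L x y) 0 :=
      hasDerivAt_transition_zero L x y
    -- the two functions agree on `[0, ∞)` only, so that one-sided derivatives are compared
    have h3 : HasDerivWithinAt (fun s => transition L s x y)
        (∑ h : S →o S with h x = y, G OrderHom.id h) (Set.Ici 0) 0 :=
      h1.hasDerivWithinAt.congr (fun t ht => (hP t ht x y).symm) (hP 0 le_rfl x y).symm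
    have h4 := (uniqueDiffWithinAt_Ici (0 : ℝ)).eq_deriv _ h3 h2.hasDerivWithinAt
    rw [← h4, Finset.sum_filter]
    refine Finset.sum_congr rfl fun h _ => ?_
    by_cases hh : h = OrderHom.id
    · subst hh
      simp [hxy]
    · simp [hh]

/-- Maps drawn at rates `w` are composed on the left, so that the image of a point performs a
Markov process with the given generator. -/
lemma RateRealizable.realizablyMonotone {L : Matrix S S ℝ} (hL : IsGenerator L)
    (h : RateRealizable L) : RealizablyMonotone (transition L) := by
  obtain ⟨w, hw, hq⟩ := h
  have hdiag : ∀ x y, ∑ h : S →o S, (if h x = y then w h else 0) -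
      (if x = y then ∑ h, w h else 0) = L x y := by
    have hoff : ∀ x y, x ≠ y → ∑ h : S →o S, (if h x = y then w h else 0) -
        (if x = y then ∑ h, w h else 0) = L x y := by
      intro x y hxy
      rw [hq x y hxy, if_neg hxy, sub_zero]
    intro x y
    by_cases hxy : x = y
    · subst hxy
      have h1 := hL.row_sum x
      have h2 : ∑ y, (∑ h : S →o S, (if h x = y then w h else 0) -
          (if x = y then ∑ h, w h else 0)) = 0 := by
        rw [Finset.sum_sub_distrib, Finset.sum_comm]
        simp
      rw [← Finset.add_sum_erase _ _ (Finset.mem_univ x)] at h1 h2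
      have h3 : ∑ y ∈ Finset.univ.erase x, (∑ h : S →o S, (if h x = y then w h else 0) -
          (if x = y then ∑ h, w h else 0)) = ∑ y ∈ Finset.univ.erase x, L x y :=
        Finset.sum_congr rfl fun y hy => hoff x y (Finset.ne_of_mem_erase hy).symm
      rw [h3] at h2
      linarith
    · exact hoff x y hxy
  let G : Matrix (S →o S) (S →o S) ℝ := fun f g =>
    ∑ h : S →o S, (if h.comp f = g then w h else 0) - (if f = g then ∑ h, w h else 0)
  have hGL : ∀ f x y, ∑ g : S →o S, (if g x = y then G f g else 0) = L (f x) y := by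
    intro f x y
    have e : ∀ g : S →o S, (if g x = y then G f g else 0) =
        ∑ h : S →o S, (if h.comp f = g then (if g x = y then w h else 0) else 0) -
          (if f = g then (if g x = y then ∑ h, w h else 0) else 0) := by
      intro g
      by_cases hg : g x = y <;> simp [hg, G]
    rw [← hdiag, Finset.sum_congr rfl fun g _ => e g, Finset.sum_sub_distrib, Finset.sum_comm]
    simp
  refine ⟨G, ⟨fun f g hfg => ?_, fun f => ?_⟩, fun t _ x y => ?_⟩
  · simp only [G, if_neg hfg, sub_zero]
    exact Finset.sum_nonneg fun h _ => by split_ifs; exacts [hw h, le_rfl]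
  · simp only [G]
    rw [Finset.sum_sub_distrib, Finset.sum_comm]
    simp
  · have hpow : ∀ n : ℕ, ∀ f : S →o S,
        ∑ g : S →o S, (if g x = y then (G ^ n) f g else 0) = (L ^ n) (f x) y := by
      intro n
      induction n with
      | zero =>
        intro f
        have e : ∀ g : S →o S, (if g x = y then (1 : Matrix (S →o S) (S →o S) ℝ) f g else 0) =
            if f = g then (if g x = y then 1 else 0) else 0 := by
          intro g
          rw [Matrix.one_apply]
          split_ifs <;> rfl
        simp only [pow_zero]
        rw [Finset.sum_congr rfl fun g _ => e g]
        simp [Matrix.one_apply]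
      | succ n ih =>
        intro f
        have e : ∀ g : S →o S, (if g x = y then (G ^ (n + 1)) f g else 0) =
            ∑ k : S →o S, G f k * (if g x = y then (G ^ n) k g else 0) := by
          intro g
          rw [pow_succ', Matrix.mul_apply]
          split_ifs <;> simp
        rw [Finset.sum_congr rfl fun g _ => e g, Finset.sum_comm]
        simp_rw [← Finset.mul_sum, ih]
        rw [pow_succ', Matrix.mul_apply]
        simp_rw [← hGL, Finset.sum_mul]
        rw [Finset.sum_comm]
        refine Finset.sum_congr rfl fun k _ => ?_
        simp
    have h1 := hasSum_sum (s := Finset.univ.filter fun h : S →o S => h x = y)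
      fun h _ => hasSum_transition G t OrderHom.id h
    refine h1.unique ?_
    convert hasSum_transition L t x y using 2 with n
    have h2 := hpow n OrderHom.id
    rw [← Finset.mul_sum, ← Finset.mul_sum, Finset.sum_filter]
    refine congrArg _ (congrArg _ ?_)
    convert h2
    rfl

lemma RealizablyMonotone.stochasticallyMonotone {L : Matrix S S ℝ}
    (h : RealizablyMonotone (transition L)) : StochasticallyMonotone (transition L) := by
  obtain ⟨G, hG, hP⟩ := h
  intro t ht x y hxy U hU
  have key : ∀ x, ∑ z with z ∈ U, transition L t x z =
      ∑ h : S →o S, if h x ∈ U then transition G t OrderHom.id h else 0 := by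
    intro x
    simp_rw [← hP t ht x, Finset.sum_filter]
    have : ∀ z, (if z ∈ U then ∑ h : S →o S, (if h x = z then transition G t OrderHom.id h else 0)
        else 0) = ∑ h : S →o S,
          (if h x = z then (if z ∈ U then transition G t OrderHom.id h else 0) else 0) := by
      intro z
      split_ifs <;> simp
    simp_rw [this]
    rw [Finset.sum_comm]
    simp
  rw [key, key]
  refine Finset.sum_le_sum fun h _ => ?_
  have h0 := hG.transition_nonneg ht OrderHom.id h
  by_cases hx : h x ∈ U
  · rw [if_pos hx, if_pos (hU (h.monotone hxy) hx)]
  · rw [if_neg hx]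
    split_ifs
    exacts [h0, le_rfl]

/-- The infinitesimal form of stochastic monotonicity, at pairs that an up-set does not
separate. -/
lemma StochasticallyMonotone.sum_le {L : Matrix S S ℝ}
    (h : StochasticallyMonotone (transition L)) {x y : S} (hxy : x ≤ y) {U : Set S}
    (hU : IsUpperSet U) (hiff : x ∈ U ↔ y ∈ U) :
    ∑ z, U.indicator (L x) z ≤ ∑ z, U.indicator (L y) z := by
  have hd : ∀ x, HasDerivAt (fun t => ∑ z with z ∈ U, transition L t x z)
      (∑ z, U.indicator (L x) z) 0 := by
    intro x
    have e : ∑ z, U.indicator (L x) z = ∑ z with z ∈ U, L x z := by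
      rw [Finset.sum_filter]
      rfl
    rw [e]
    exact HasDerivAt.fun_sum fun z _ => hasDerivAt_transition_zero L x z
  have h0 : ∀ x, ∑ z with z ∈ U, transition L 0 x z = if x ∈ U then 1 else 0 := by
    intro x
    rw [transition_zero, Finset.sum_filter]
    simp only [Matrix.one_apply]
    by_cases hx : x ∈ U
    · rw [Finset.sum_eq_single x] <;> simp +contextual [hx, eq_comm]
    · rw [if_neg hx]
      refine Finset.sum_eq_zero fun z _ => ?_
      by_cases hz : z ∈ U
      · have : x ≠ z := fun e => hx (e ▸ hz)
        simp [this]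
      · simp [hz]
  have hdiff := ((hd y).sub (hd x)).hasDerivWithinAt (s := Set.Ioi 0)
  have hlim := (hasDerivWithinAt_iff_tendsto_slope' (by simp)).1 hdiff
  have h5 : 0 ≤ ∑ z, U.indicator (L y) z - ∑ z, U.indicator (L x) z := by
    refine ge_of_tendsto hlim ?_
    filter_upwards [self_mem_nhdsWithin] with t ht
    have ht' : (0 : ℝ) < t := ht
    rw [slope_def_field]
    simp only [Pi.sub_apply]
    have e : (if y ∈ U then (1 : ℝ) else 0) = if x ∈ U then 1 else 0 := by simp only [hiff]
    rw [h0, h0, e, sub_self, sub_zero, sub_zero]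
    exact div_nonneg (sub_nonneg.2 (h t ht'.le x y hxy U hU)) ht'.le
  linarith

/-- Rows of three equally likely targets which are pairwise matched along the order define a
kernel; if its off-diagonal rates are not realizable, then monotonicity equivalence fails. -/
def HasUnrealizableRows (S : Type*) [Fintype S] [PartialOrder S] : Prop :=
  ∃ R : S → Fin 3 → S, (∀ x y, x ≤ y → ∃ σ : Equiv.Perm (Fin 3), ∀ i, R x i ≤ R y (σ i)) ∧
    ¬ RateRealizable fun x y => ∑ i, if R x i = y then (1 : ℝ) else 0

lemma HasUnrealizableRows.not_monotonicityEquivalence (h : HasUnrealizableRows S) :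
    ¬ MonotonicityEquivalence S := by
  obtain ⟨R, hR, hq⟩ := h
  intro hME
  let Q : Matrix S S ℝ := fun x y => ∑ i, if R x i = y then (1 : ℝ) else 0
  have hQ : ∀ (φ : S → ℝ) x, ∑ z, Q x z * φ z = ∑ i, φ (R x i) := by
    intro φ x
    simp only [Q, Finset.sum_mul]
    rw [Finset.sum_comm]
    simp
  have hmono : ∀ φ : S → ℝ, Monotone φ → Monotone fun x => ∑ z, Q x z * φ z := by
    intro φ hφ x y hxy
    obtain ⟨σ, hσ⟩ := hR x y hxy
    simp only [hQ]
    rw [← Equiv.sum_comp σ fun i => φ (R y i)]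
    exact Finset.sum_le_sum fun i _ => hφ (hσ i)
  have hgen : IsGenerator (Q + (-3 : ℝ) • (1 : Matrix S S ℝ)) := by
    refine ⟨fun x y hxy => ?_, fun x => ?_⟩
    · simp only [Matrix.add_apply, Matrix.smul_apply, Matrix.one_apply_ne hxy, smul_zero, add_zero]
      exact Finset.sum_nonneg fun i _ => by split_ifs <;> norm_num
    · have := hQ (fun _ => 1) x
      simp only [mul_one] at this
      simp [Matrix.add_apply, Finset.sum_add_distrib, this, Matrix.one_apply]
  have hpow : ∀ n : ℕ, ∀ φ : S → ℝ, Monotone φ →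
      Monotone fun x => ∑ z, (Q ^ n) x z * φ z := by
    intro n
    induction n with
    | zero =>
      intro φ hφ
      simpa [Matrix.one_apply] using hφ
    | succ n ih =>
      intro φ hφ
      convert ih _ (hmono φ hφ) using 2 with x
      simp_rw [pow_succ, Matrix.mul_apply, Finset.sum_mul, Finset.mul_sum]
      rw [Finset.sum_comm]
      simp_rw [mul_assoc]
  have hst : StochasticallyMonotone (transition (Q + (-3 : ℝ) • (1 : Matrix S S ℝ))) := by
    intro t ht x y hxy U hU
    rw [transition_add_smul_one]
    simp only [Matrix.smul_apply, smul_eq_mul, ← Finset.mul_sum]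
    refine mul_le_mul_of_nonneg_left ?_ (Real.exp_pos _).le
    have hs := fun x => hasSum_sum (s := Finset.univ.filter fun z => z ∈ U)
      fun z _ => hasSum_transition Q t x z
    refine hasSum_le (fun n => ?_) (hs x) (hs y)
    simp_rw [← Finset.mul_sum]
    refine mul_le_mul_of_nonneg_left (mul_le_mul_of_nonneg_left ?_ (pow_nonneg ht n))
      (by positivity)
    have := hpow n (U.indicator fun _ => 1) (by
      intro a b hab
      by_cases ha : a ∈ U
      · simp [ha, hU hab ha]
      · simp only [Set.indicator_of_notMem ha]
        exact Set.indicator_nonneg (by simp) _) hxy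
    simpa [Finset.sum_filter, Set.indicator_apply] using this
  obtain ⟨w, hw, hwq⟩ := ((hME _ hgen).1 hst).rateRealizable
  refine hq ⟨w, hw, fun x y hxy => ?_⟩
  rw [hwq x y hxy, Matrix.add_apply, Matrix.smul_apply, Matrix.one_apply_ne hxy, smul_zero,
    add_zero]

lemma HasUnrealizableRows.of_orderDual (h : HasUnrealizableRows Sᵒᵈ) :
    HasUnrealizableRows S := by
  obtain ⟨R, hR, hq⟩ := h
  refine ⟨fun x i => OrderDual.ofDual (R (OrderDual.toDual x) i), fun x y hxy => ?_,
    fun hw => hq ?_⟩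
  · obtain ⟨σ, hσ⟩ := hR (OrderDual.toDual y) (OrderDual.toDual x) hxy
    refine ⟨σ.symm, fun i => ?_⟩
    have := hσ (σ.symm i)
    rw [Equiv.apply_symm_apply] at this
    exact this
  · obtain ⟨w, hw, hwq⟩ := hw
    refine ⟨fun h => w (OrderHom.dual.symm h), fun h => hw _, fun x y hxy => ?_⟩
    refine Eq.trans ?_ (hwq (OrderDual.ofDual x) (OrderDual.ofDual y) hxy)
    exact (Equiv.sum_comp OrderHom.dual.symm fun h : S →o S =>
      if h (OrderDual.ofDual x) = OrderDual.ofDual y then w h else 0)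

end Realizable

/-! ### Acyclic posets and cuts -/

/-- `V` contains `v` but not `u` and is crossed by no cover other than `u ⋖ v`: the side of `v`
of the edge `u ⋖ v` of the Hasse diagram, possibly together with components that do not contain the
edge. For `u ⋖ v` such a set is an up-set, see `IsCut.isUpperSet`. -/
structure IsCut {T : Type*} [PartialOrder T] (u v : T) (V : Set T) : Prop where
  bot_notMem : u ∉ V
  top_mem : v ∈ V
  mem_iff : ∀ x y, x ⋖ y → (x ≠ u ∨ y ≠ v) → (x ∈ V ↔ y ∈ V)

/-- No cover leads into or out of `W`. -/
def IsUncrossed {T : Type*} [PartialOrder T] (W : Set T) : Prop :=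
  ∀ x y : T, x ⋖ y → (x ∈ W ↔ y ∈ W)

section Order

variable {T : Type*} [PartialOrder T]

lemma reflTransGen_covBy_of_le [Finite T] {x y : T} (h : x ≤ y) :
    Relation.ReflTransGen (· ⋖ ·) x y := by
  classical
  have := Fintype.ofFinite T
  let _ : LocallyFiniteOrder T := Fintype.toLocallyFiniteOrder
  exact le_iff_reflTransGen_covBy.1 h

lemma le_of_reflTransGen_covBy {x y : T} (h : Relation.ReflTransGen (· ⋖ ·) x y) : x ≤ y := by
  induction h with
  | refl => exact le_rfl
  | tail _ h ih => exact ih.trans h.le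

lemma exists_covBy_top_le [Finite T] {x y : T} (h : x < y) : ∃ z, x ⋖ z ∧ z ≤ y := by
  rcases (reflTransGen_covBy_of_le h.le).cases_head with e | ⟨z, hz, hzy⟩
  · exact absurd e h.ne
  · refine ⟨z, hz, ?_⟩
    clear hz h
    induction hzy with
    | refl => exact le_rfl
    | tail _ h ih => exact ih.trans h.le

lemma exists_le_bot_covBy [Finite T] {x y : T} (h : x < y) : ∃ z, x ≤ z ∧ z ⋖ y := by
  obtain ⟨z, hz, hzx⟩ := exists_covBy_top_le (T := Tᵒᵈ) (x := OrderDual.toDual y)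
    (y := OrderDual.toDual x) h
  exact ⟨OrderDual.ofDual z, hzx, hz.ofDual⟩

/-- Acyclicity means that each edge of the Hasse diagram is a bridge. -/
lemma acyclicPoset_iff_exists_isCut :
    AcyclicPoset T ↔ ∀ u v : T, u ⋖ v → ∃ V, IsCut u v V := by
  unfold AcyclicPoset
  rw [SimpleGraph.isAcyclic_iff_forall_adj_isBridge]
  constructor
  · intro h u v huv
    have hb := h (v := u) (w := v) (Or.inl huv)
    rw [SimpleGraph.isBridge_iff] at hb
    refine ⟨{z | ((SimpleGraph.hasse T).deleteEdges {s(u, v)}).Reachable v z},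
      fun h => hb h.symm, SimpleGraph.Reachable.refl _, fun x y hxy hne => ?_⟩
    have hadj : ((SimpleGraph.hasse T).deleteEdges {s(u, v)}).Adj x y := by
      rw [SimpleGraph.deleteEdges_adj]
      refine ⟨Or.inl hxy, fun he => ?_⟩
      rcases Sym2.eq_iff.1 (Set.mem_singleton_iff.1 he) with ⟨rfl, rfl⟩ | ⟨rfl, rfl⟩
      · simp at hne
      · exact hxy.lt.not_gt huv.lt
    exact ⟨fun h => h.trans hadj.reachable, fun h => h.trans hadj.symm.reachable⟩
  · intro h
    have key : ∀ u v : T, u ⋖ v → (SimpleGraph.hasse T).IsBridge s(u, v) := by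
      intro u v huv
      obtain ⟨V, hV⟩ := h u v huv
      rw [SimpleGraph.isBridge_iff]
      rintro ⟨w⟩
      have : ∀ {a b : T} (w : ((SimpleGraph.hasse T).deleteEdges {s(u, v)}).Walk a b),
          a ∈ V ↔ b ∈ V := by
        intro a b w
        induction w with
        | nil => rfl
        | cons hadj _ ih =>
          rw [← ih]
          rw [SimpleGraph.deleteEdges_adj] at hadj
          obtain ⟨hc | hc, hne⟩ := hadj
          · refine hV.mem_iff _ _ hc ?_
            by_contra! hcon
            exact hne (by simp [hcon])
          · refine (hV.mem_iff _ _ hc ?_).symm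
            by_contra! hcon
            exact hne (by simp [hcon, Sym2.eq_swap])
      exact hV.bot_notMem ((this w).2 hV.top_mem)
    rintro v w (hvw | hvw)
    · exact key v w hvw
    · rw [Sym2.eq_swap]
      exact key w v hvw

lemma AcyclicPoset.exists_isCut (h : AcyclicPoset T) {u v : T} (huv : u ⋖ v) :
    ∃ V, IsCut u v V :=
  acyclicPoset_iff_exists_isCut.1 h u v huv

lemma IsCut.dual {u v : T} {V : Set T} (h : IsCut u v V) :
    IsCut (OrderDual.toDual v) (OrderDual.toDual u) (OrderDual.ofDual ⁻¹' Vᶜ) where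
  bot_notMem := fun hn => hn h.top_mem
  top_mem := h.bot_notMem
  mem_iff := fun x y hxy hne =>
    not_congr (h.mem_iff (OrderDual.ofDual y) (OrderDual.ofDual x) hxy.ofDual hne.symm).symm

lemma AcyclicPoset.dual (h : AcyclicPoset T) : AcyclicPoset Tᵒᵈ := by
  rw [acyclicPoset_iff_exists_isCut]
  intro u v huv
  obtain ⟨V, hV⟩ := h.exists_isCut huv.ofDual
  exact ⟨_, hV.dual⟩

lemma AcyclicPoset.of_orderIso {T' : Type*} [PartialOrder T'] (h : AcyclicPoset T)
    (f : T' ≃o T) : AcyclicPoset T' := by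
  rw [acyclicPoset_iff_exists_isCut]
  intro u v huv
  obtain ⟨V, hV⟩ := h.exists_isCut ((apply_covBy_apply_iff f).2 huv)
  exact ⟨f ⁻¹' V, hV.bot_notMem, hV.top_mem, fun x y hxy hne =>
    hV.mem_iff _ _ ((apply_covBy_apply_iff f).2 hxy) (by simpa using hne)⟩

/-- Acyclicity passes to order-convex subposets, whose covers are covers of the whole poset. -/
lemma AcyclicPoset.subtype (h : AcyclicPoset T) {P : Set T}
    (hP : ∀ x ∈ P, ∀ y ∈ P, ∀ z, x < z → z < y → z ∈ P) : AcyclicPoset P := by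
  have hcov : ∀ x y : P, x ⋖ y → x.1 ⋖ y.1 := fun x y hxy =>
    ⟨hxy.lt, fun z hz hzy => hxy.2 (c := ⟨z, hP _ x.2 _ y.2 z hz hzy⟩) hz hzy⟩
  rw [acyclicPoset_iff_exists_isCut]
  intro u v huv
  obtain ⟨V, hV⟩ := h.exists_isCut (hcov u v huv)
  exact ⟨Subtype.val ⁻¹' V, hV.bot_notMem, hV.top_mem, fun x y hxy hne =>
    hV.mem_iff _ _ (hcov x y hxy) (by simpa [Subtype.ext_iff] using hne)⟩

namespace IsCut

variable {u v : T} {V : Set T}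

/-- A chain of covers from outside a cut to its inside passes through the edge of the cut. -/
lemma le_of_notMem_of_mem [Finite T] (h : IsCut u v V) {x y : T} (hxy : x ≤ y)
    (hx : x ∉ V) (hy : y ∈ V) : x ≤ u ∧ v ≤ y := by
  have := reflTransGen_covBy_of_le hxy
  clear hxy
  induction this with
  | refl => exact absurd hy hx
  | @tail b c hb hbc ih =>
    by_cases hbV : b ∈ V
    · exact ⟨(ih hbV).1, (ih hbV).2.trans hbc.le⟩
    · have : b = u ∧ c = v := by
        by_contra hne
        exact hbV ((h.mem_iff b c hbc (by tauto)).2 hy)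
      obtain ⟨rfl, rfl⟩ := this
      exact ⟨le_of_reflTransGen_covBy hb, le_rfl⟩

lemma isUpperSet [Finite T] (h : IsCut u v V) (huv : u ⋖ v) : IsUpperSet V := by
  intro x y hxy hx
  have := reflTransGen_covBy_of_le hxy
  clear hxy
  induction this with
  | refl => exact hx
  | @tail b c _ hbc ih =>
    refine (h.mem_iff b c hbc ?_).1 ih
    left
    rintro rfl
    exact h.bot_notMem ih

end IsCut

lemma IsUncrossed.mem_iff_of_le [Finite T] {W : Set T} (hW : IsUncrossed W) {x y : T}
    (hxy : x ≤ y) : x ∈ W ↔ y ∈ W := by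
  have := reflTransGen_covBy_of_le hxy
  clear hxy
  induction this with
  | refl => rfl
  | tail _ h ih => exact ih.trans (hW _ _ h)

lemma IsUncrossed.mem_of_mem (hT : (SimpleGraph.hasse T).Preconnected) {W : Set T}
    (hW : IsUncrossed W) {x : T} (hx : x ∈ W) (y : T) : y ∈ W := by
  obtain ⟨w⟩ := hT x y
  induction w with
  | nil => exact hx
  | cons hadj _ ih =>
    refine ih ?_
    rcases hadj with h | h
    · exact (hW _ _ h).1 hx
    · exact (hW _ _ h).2 hx

lemma preconnected_of_forall_isUncrossed
    (h : ∀ W : Set T, IsUncrossed W → ∀ x ∈ W, ∀ y, y ∈ W) :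
    (SimpleGraph.hasse T).Preconnected := by
  intro x y
  refine h {z | (SimpleGraph.hasse T).Reachable x z} (fun a b hab => ?_) x
    (SimpleGraph.Reachable.refl _) y
  have hadj : (SimpleGraph.hasse T).Adj a b := Or.inl hab
  exact ⟨fun h => h.trans hadj.reachable, fun h => h.trans hadj.symm.reachable⟩

/-- If `p` and `q` have a common lower bound `x`, the ways up from `x` to `p` and to `q` part
at the lower end of some edge, a cut of which separates `p` from `q`. -/
lemma AcyclicPoset.exists_isCut_of_not_le [Finite T] (hT : AcyclicPoset T) {x p q : T}
    (hxp : x ≤ p) (hxq : x ≤ q) (hpq : ¬ p ≤ q) :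
    ∃ m v V, IsCut m v V ∧ m ⋖ v ∧ x ≤ m ∧ m ≤ q ∧ v ≤ p ∧ p ∈ V ∧ q ∉ V := by
  obtain ⟨m, ⟨hxm, hmp, hmq⟩, hmax⟩ :=
    (Set.toFinite {m | x ≤ m ∧ m ≤ p ∧ m ≤ q}).exists_maximal ⟨x, le_rfl, hxp, hxq⟩
  have hlt : m < p := lt_of_le_of_ne hmp fun e => hpq (e ▸ hmq)
  obtain ⟨v, hmv, hvp⟩ := exists_covBy_top_le hlt
  obtain ⟨V, hV⟩ := hT.exists_isCut hmv
  have hvq : ¬ v ≤ q := fun hvq => hmv.lt.not_ge (hmax ⟨hxm.trans hmv.le, hvp, hvq⟩ hmv.le)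
  exact ⟨m, v, V, hV, hmv, hxm, hmq, hvp, hV.isUpperSet hmv hvp hV.top_mem,
    fun hq => hvq (hV.le_of_notMem_of_mem hmq hV.bot_notMem hq).2⟩

/-- Intervals of an acyclic poset are chains. -/
lemma AcyclicPoset.le_or_le [Finite T] (hT : AcyclicPoset T) {x p q y : T}
    (hxp : x ≤ p) (hxq : x ≤ q) (hpy : p ≤ y) (hqy : q ≤ y) : p ≤ q ∨ q ≤ p := by
  by_contra! h
  obtain ⟨m, v, V, hV, hmv, -, -, hvp, hp, hq⟩ := hT.exists_isCut_of_not_le hxp hxq h.1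
  have hy := hV.isUpperSet hmv hpy hp
  exact h.2 ((hV.le_of_notMem_of_mem hqy hq hy).1.trans (hmv.le.trans hvp))

/-- Two common upper bounds of `a₁` and `a₂` that are not ordered leave room for an element
in the middle. -/
lemma AcyclicPoset.exists_between [Finite T] (hT : AcyclicPoset T) {a₁ a₂ b₁ b₂ : T}
    (h₁₁ : a₁ ≤ b₁) (h₁₂ : a₁ ≤ b₂) (h₂₁ : a₂ ≤ b₁) (h₂₂ : a₂ ≤ b₂) (hb : ¬ b₁ ≤ b₂) :
    ∃ m, a₁ ≤ m ∧ a₂ ≤ m ∧ m ≤ b₁ ∧ m ≤ b₂ := by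
  obtain ⟨m, v, V, hV, hmv, ham, hmq, hvp, hp, hq⟩ := hT.exists_isCut_of_not_le h₁₁ h₁₂ hb
  have ha₂ : a₂ ∉ V := fun h => hq (hV.isUpperSet hmv h₂₂ h)
  exact ⟨m, ham, (hV.le_of_notMem_of_mem h₂₁ ha₂ hp).1, hmv.le.trans hvp, hmq⟩

lemma AcyclicPoset.covBy_unique_top [Finite T] (hT : AcyclicPoset T) {x v v' y : T}
    (hv : x ⋖ v) (hv' : x ⋖ v') (hvy : v ≤ y) (hvy' : v' ≤ y) : v = v' := by
  rcases hT.le_or_le hv.le hv'.le hvy hvy' with h | h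
  · exact (eq_of_le_of_not_lt h fun hlt => hv'.2 hv.lt hlt)
  · exact (eq_of_le_of_not_lt h fun hlt => hv.2 hv'.lt hlt).symm

lemma AcyclicPoset.covBy_unique_bot [Finite T] (hT : AcyclicPoset T) {x v v' y : T}
    (hv : v ⋖ y) (hv' : v' ⋖ y) (hxv : x ≤ v) (hxv' : x ≤ v') : v = v' := by
  rcases hT.le_or_le hxv hxv' hv.le hv'.le with h | h
  · exact (eq_of_le_of_not_lt h fun hlt => hv.2 hlt hv'.lt)
  · exact (eq_of_le_of_not_lt h fun hlt => hv'.2 hlt hv.lt).symm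

/-- A branch above `c` lies on the upper side of each edge from below to `c`. -/
lemma IsCut.mem_of_mem_of_covBy (hT : (SimpleGraph.hasse T).Preconnected) {c k l : T}
    {V V' : Set T} (hV : IsCut k c V) (hV' : IsCut c l V') (hk : k ⋖ c) (hl : c ⋖ l)
    {z : T} (hz : z ∈ V') : z ∈ V := by
  by_contra hzV
  have h1 : k ∉ V' := fun h =>
    hV'.bot_notMem ((hV'.mem_iff k c hk (Or.inl hk.lt.ne)).1 h)
  have h2 : l ∈ V := (hV.mem_iff c l hl (Or.inl hk.lt.ne')).1 hV.top_mem
  have hW : IsUncrossed (Vᶜ ∩ V') := by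
    intro x y hxy
    by_cases e : x = c ∧ y = l
    · obtain ⟨rfl, rfl⟩ := e
      exact ⟨fun h => absurd h.2 hV'.bot_notMem, fun h => absurd h2 h.1⟩
    by_cases e' : x = k ∧ y = c
    · obtain ⟨rfl, rfl⟩ := e'
      exact ⟨fun h => absurd h.2 h1, fun h => absurd hV.top_mem h.1⟩
    exact and_congr (not_congr (hV.mem_iff x y hxy (by tauto))) (hV'.mem_iff x y hxy (by tauto))
  exact hV'.bot_notMem (hW.mem_of_mem hT (x := z) ⟨hzV, hz⟩ c).2

end Order

/-! ### Couplings along the Hasse diagram -/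

section Coupling

open scoped Classical

/-- On a connected acyclic poset, a function `D` with total mass zero is the divergence of the
flow that sends the mass of `V u v` through the edge `u ⋖ v`. -/
lemma eq_sum_mass_cut {T : Type*} [PartialOrder T] [Fintype T]
    (hT : (SimpleGraph.hasse T).Preconnected) {V : T → T → Set T}
    (hV : ∀ u v, u ⋖ v → IsCut u v (V u v)) (D : T → ℝ) (hD : ∑ z, D z = 0) (x : T) :
    D x = ∑ u, (if u ⋖ x then ∑ z, (V u x).indicator D z else 0) -
      ∑ v, (if x ⋖ v then ∑ z, (V x v).indicator D z else 0) := by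
  let g : T → ℝ := fun z => ∑ u, (if u ⋖ x then (V u x).indicator (fun _ => (1 : ℝ)) z else 0) -
    ∑ v, (if x ⋖ v then (V x v).indicator (fun _ => (1 : ℝ)) z else 0) - if z = x then 1 else 0
  -- crossing the edge `a ⋖ b` changes the indicator of `V a b` only
  have hcross : ∀ u v a b, u ⋖ v → a ⋖ b → (V u v).indicator (fun _ => (1 : ℝ)) b =
      (V u v).indicator (fun _ => (1 : ℝ)) a + if u = a ∧ v = b then 1 else 0 := by
    intro u v a b huv hab
    have hc := hV u v huv
    by_cases h : u = a ∧ v = b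
    · obtain ⟨rfl, rfl⟩ := h
      simp [hc.bot_notMem, hc.top_mem]
    · have := hc.mem_iff a b hab (by tauto)
      rw [if_neg h, add_zero]
      by_cases ha : a ∈ V u v
      · rw [Set.indicator_of_mem ha, Set.indicator_of_mem (this.1 ha)]
      · rw [Set.indicator_of_notMem ha, Set.indicator_of_notMem (this.not.1 ha)]
  have hconst : ∀ z, g z = g x := by
    intro z
    have hW : IsUncrossed {z | g z = g x} := by
      intro a b hab
      have h1 : ∑ u, (if u ⋖ x then (V u x).indicator (fun _ => (1 : ℝ)) b else 0) =
          ∑ u, (if u ⋖ x then (V u x).indicator (fun _ => (1 : ℝ)) a else 0) +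
            if b = x then 1 else 0 := by
        have e : ∀ u, (if u ⋖ x then (V u x).indicator (fun _ => (1 : ℝ)) b else 0) =
            (if u ⋖ x then (V u x).indicator (fun _ => (1 : ℝ)) a else 0) +
              if u = a then (if b = x then 1 else 0) else 0 := by
          intro u
          by_cases hu : u ⋖ x
          · rw [if_pos hu, if_pos hu, hcross u x a b hu hab]
            congr 1
            by_cases h1 : u = a <;> by_cases h2 : b = x <;> simp [h1, h2, eq_comm (a := x)]
          · rw [if_neg hu, if_neg hu]
            by_cases h1 : u = a
            · subst h1
              have : b ≠ x := fun e => hu (e ▸ hab)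
              simp [this]
            · simp [h1]
        rw [Finset.sum_congr rfl fun u _ => e u, Finset.sum_add_distrib]
        simp
      have h2 : ∑ v, (if x ⋖ v then (V x v).indicator (fun _ => (1 : ℝ)) b else 0) =
          ∑ v, (if x ⋖ v then (V x v).indicator (fun _ => (1 : ℝ)) a else 0) +
            if a = x then 1 else 0 := by
        have e : ∀ v, (if x ⋖ v then (V x v).indicator (fun _ => (1 : ℝ)) b else 0) =
            (if x ⋖ v then (V x v).indicator (fun _ => (1 : ℝ)) a else 0) +
              if v = b then (if a = x then 1 else 0) else 0 := by
          intro v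
          by_cases hv : x ⋖ v
          · rw [if_pos hv, if_pos hv, hcross x v a b hv hab]
            congr 1
            by_cases h1 : v = b <;> by_cases h2 : a = x <;> simp [h1, h2, eq_comm (a := x)]
          · rw [if_neg hv, if_neg hv]
            by_cases h1 : v = b
            · subst h1
              have : a ≠ x := fun e => hv (e ▸ hab)
              simp [this]
            · simp [h1]
        rw [Finset.sum_congr rfl fun u _ => e u, Finset.sum_add_distrib]
        simp
      have : g a = g b := by
        simp only [g]
        rw [h1, h2]
        ring
      simp [this]
    exact hW.mem_of_mem hT (x := x) rfl z
  have h0 : ∑ z, D z * g z = 0 := by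
    rw [Finset.sum_congr rfl fun z _ => by rw [hconst z], ← Finset.sum_mul, hD, zero_mul]
  have hexp : ∀ z, D z * g z = ∑ u, (if u ⋖ x then (V u x).indicator D z else 0) -
      ∑ v, (if x ⋖ v then (V x v).indicator D z else 0) - if z = x then D z else 0 := by
    intro z
    simp only [g, mul_sub, Finset.mul_sum, mul_ite, mul_zero, mul_one, Set.indicator_apply]
  simp_rw [hexp, Finset.sum_sub_distrib] at h0
  rw [Finset.sum_comm, Finset.sum_comm (f := fun z v => if x ⋖ v then _ else _)] at h0
  have e1 : ∀ u, (∑ z, if u ⋖ x then (V u x).indicator D z else 0) =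
      if u ⋖ x then ∑ z, (V u x).indicator D z else 0 := by
    intro u; split_ifs <;> simp
  have e2 : ∀ v, (∑ z, if x ⋖ v then (V x v).indicator D z else 0) =
      if x ⋖ v then ∑ z, (V x v).indicator D z else 0 := by
    intro u; split_ifs <;> simp
  simp_rw [e1, e2] at h0
  rw [Finset.sum_ite_eq' Finset.univ x D, if_pos (Finset.mem_univ x)] at h0
  linarith

/-- `κ` is a coupling of `P` and `Q` that moves mass upwards only. -/
structure IsMonotoneCoupling {T : Type*} [PartialOrder T] [Fintype T] (P Q : T → ℝ)
    (κ : T → T → ℝ) : Prop where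
  nonneg : ∀ x z, 0 ≤ κ x z
  sum_right : ∀ x, ∑ z, κ x z = P x
  sum_left : ∀ z, ∑ x, κ x z = Q z
  le_of_ne_zero : ∀ x z, κ x z ≠ 0 → x ≤ z

/-- An upward flow from `P` to `Q` yields a coupling: the mass on an edge whose lower end is
minimal among the edges in use can be moved at once, since nothing has to flow in before. -/
lemma exists_isMonotoneCoupling_of_flow {T : Type*} [PartialOrder T] [Fintype T]
    (F : T → T → ℝ) (hF : ∀ u v, 0 ≤ F u v) (hlt : ∀ u v, F u v ≠ 0 → u < v)
    (P Q : T → ℝ) (hP : ∀ x, 0 ≤ P x) (hQ : ∀ x, 0 ≤ Q x)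
    (hbal : ∀ x, Q x = P x + ∑ u, F u x - ∑ v, F x v) : ∃ κ, IsMonotoneCoupling P Q κ := by
  induction hn : (Finset.univ.filter fun e : T × T => F e.1 e.2 ≠ 0).card using
    Nat.strong_induction_on generalizing F P with
  | _ n ih =>
  by_cases hF0 : ∀ u v, F u v = 0
  · have hPQ : ∀ x, Q x = P x := fun x => by simp [hbal x, hF0]
    refine ⟨fun x z => if x = z then P x else 0, fun x z => ?_, fun x => by simp,
      fun z => by simp [hPQ], fun x z h => ?_⟩
    · split_ifs
      exacts [hP x, le_rfl]
    · split_ifs at h with e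
      exacts [e.le, absurd rfl h]
  push Not at hF0
  obtain ⟨u, ⟨v, huv⟩, hmin⟩ := (Set.toFinite {u | ∃ v, F u v ≠ 0}).exists_minimal hF0
  have hin : ∀ w, F w u = 0 := by
    intro w
    by_contra hw
    have h1 := hlt w u hw
    exact h1.not_ge (hmin ⟨u, hw⟩ h1.le)
  have hlt' := hlt u v huv
  have hpos : 0 < F u v := lt_of_le_of_ne (hF u v) (Ne.symm huv)
  have hPu : F u v ≤ P u := by
    have h1 := hbal u
    have h2 := Finset.single_le_sum (f := fun v => F u v) (fun i _ => hF u i) (Finset.mem_univ v)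
    have h3 := hQ u
    simp only [hin, Finset.sum_const_zero] at h1
    linarith
  let F' : T → T → ℝ := fun a b => if a = u ∧ b = v then 0 else F a b
  let P' : T → ℝ := fun x => P x - (if x = u then F u v else 0) + if x = v then F u v else 0
  have hF'le : ∀ a b, F' a b = F a b - if a = u then (if b = v then F u v else 0) else 0 := by
    intro a b
    by_cases h1 : a = u <;> by_cases h2 : b = v <;> simp [F', h1, h2]
  have hP' : ∀ x, 0 ≤ P' x := by
    intro x
    simp only [P']
    have := hP x
    by_cases h1 : x = u
    · subst h1
      rw [if_pos rfl, if_neg hlt'.ne]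
      linarith
    · rw [if_neg h1]
      split_ifs <;> linarith
  obtain ⟨κ, hκ⟩ := ih _ (by
      rw [← hn]
      refine Finset.card_lt_card ⟨fun e he => ?_, fun hsub => ?_⟩
      · simp only [Finset.mem_filter, Finset.mem_univ, true_and, F'] at he ⊢
        split_ifs at he
        · exact absurd rfl he
        · exact he
      · have := hsub (Finset.mem_filter.2 ⟨Finset.mem_univ (u, v), huv⟩)
        simp [F'] at this) F' (fun a b => by
      simp only [F']
      split_ifs
      exacts [le_rfl, hF a b]) (fun a b h => by
      simp only [F'] at h
      split_ifs at h
      · exact absurd rfl h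
      · exact hlt a b h) P' hP' (fun x => by
      simp only [hF'le, P', Finset.sum_sub_distrib]
      rw [hbal x]
      simp only [Finset.sum_ite_eq', Finset.mem_univ, if_true]
      have : (∑ w, if x = u then (if w = v then F u v else 0) else 0) =
          if x = u then F u v else 0 := by
        split_ifs <;> simp
      rw [this]
      ring) rfl
  have hvu : v ≠ u := hlt'.ne'
  have hP'v : P' v = P v + F u v := by simp [P', hvu]
  have hP'pos : 0 < P' v := by have := hP v; linarith
  have hθ : F u v / P' v ≤ 1 := by
    rw [div_le_one hP'pos]
    have := hP v
    linarith
  have hθ0 : 0 < F u v / P' v := div_pos hpos hP'pos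
  -- of the mass that `κ` moves out of `v`, the share that came from `u` is sent from `u`
  refine ⟨fun x z => κ x z + (if x = u then F u v / P' v * κ v z else 0) -
      if x = v then F u v / P' v * κ v z else 0, fun x z => ?_, fun x => ?_, fun z => ?_,
      fun x z h => ?_⟩
  · have h1 := hκ.nonneg x z
    have h2 := hκ.nonneg v z
    by_cases hxv : x = v
    · subst hxv
      rw [if_neg hvu, if_pos rfl]
      nlinarith
    · rw [if_neg hxv]
      split_ifs
      · have := mul_nonneg hθ0.le h2
        linarith
      · linarith
  · rw [Finset.sum_sub_distrib, Finset.sum_add_distrib, hκ.sum_right]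
    have e : ∀ w, (∑ z, if x = w then F u v / P' v * κ v z else 0) =
        if x = w then F u v else 0 := by
      intro w
      split_ifs
      · rw [← Finset.mul_sum, hκ.sum_right, div_mul_cancel₀ _ hP'pos.ne']
      · simp
    rw [e, e]
    simp only [P']
    ring
  · rw [Finset.sum_sub_distrib, Finset.sum_add_distrib, hκ.sum_left]
    simp
  · by_cases h1 : κ x z = 0
    · have h2 : κ v z ≠ 0 := by
        intro h2
        simp [h1, h2] at h
      by_cases hxu : x = u
      · rw [hxu]
        exact hlt'.le.trans (hκ.le_of_ne_zero v z h2)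
      · by_cases hxv : x = v
        · rw [hxv] at h1
          exact absurd h1 h2
        · simp [h1, hxu, hxv] at h
    · exact hκ.le_of_ne_zero x z h1

/-- On a connected acyclic poset, stochastic ordering on the cuts alone provides a coupling. -/
lemma exists_isMonotoneCoupling_of_cut_le {T : Type*} [PartialOrder T] [Fintype T]
    (hT : (SimpleGraph.hasse T).Preconnected) {V : T → T → Set T}
    (hV : ∀ u v, u ⋖ v → IsCut u v (V u v)) (P Q : T → ℝ) (hP : ∀ x, 0 ≤ P x)
    (hQ : ∀ x, 0 ≤ Q x) (hsum : ∑ x, P x = ∑ x, Q x)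
    (hle : ∀ u v, u ⋖ v → ∑ z, (V u v).indicator P z ≤ ∑ z, (V u v).indicator Q z) :
    ∃ κ, IsMonotoneCoupling P Q κ := by
  refine exists_isMonotoneCoupling_of_flow (fun u v => if u ⋖ v then
    ∑ z, (V u v).indicator (fun z => Q z - P z) z else 0) (fun u v => ?_) (fun u v h => ?_)
    P Q hP hQ (fun x => ?_)
  · split_ifs with h
    · have := hle u v h
      have e : ∀ z, (V u v).indicator (fun z => Q z - P z) z =
          (V u v).indicator Q z - (V u v).indicator P z := fun z =>
        congrFun (Set.indicator_sub (V u v) Q P) z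
      simp_rw [e, Finset.sum_sub_distrib]
      linarith
    · exact le_rfl
  · split_ifs at h with h1
    · exact h1.lt
    · exact absurd rfl h
  · have := eq_sum_mass_cut hT hV (fun z => Q z - P z)
      (by rw [Finset.sum_sub_distrib, hsum, sub_self]) x
    linarith

/-- Couplings of the laws `P i` along the covers of an acyclic index poset can be glued to a
joint law of a random monotone map. The covers are taken into account one after the other: to
include `u ⋖ v`, the coordinates on the two sides of the edge are made conditionally independent
given the values at `u` and `v`, and these values are coupled as prescribed. -/
lemma exists_law_of_coupling {I X : Type*} [PartialOrder I] [Fintype I] [PartialOrder X]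
    [Fintype X] (hI : AcyclicPoset I) (P : I → X → ℝ) (hP : ∀ i y, 0 ≤ P i y)
    (hP1 : ∀ i, ∑ y, P i y = 1)
    (hκ : ∀ u v, u ⋖ v → ∃ κ, IsMonotoneCoupling (P u) (P v) κ) :
    ∃ M : (I → X) → ℝ, (∀ h, 0 ≤ M h) ∧
      (∀ i y, ∑ h : I → X, (if h i = y then M h else 0) = P i y) ∧
      ∀ h, M h ≠ 0 → Monotone h := by
  have hind : ∀ E : Finset (I × I), (∀ e ∈ E, e.1 ⋖ e.2) → ∃ M : (I → X) → ℝ, (∀ h, 0 ≤ M h) ∧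
      (∀ i y, ∑ h : I → X, (if h i = y then M h else 0) = P i y) ∧
      ∀ h, M h ≠ 0 → ∀ e ∈ E, h e.1 ≤ h e.2 := by
    intro E
    induction E using Finset.induction_on with
    | empty =>
      intro _
      refine ⟨fun h => ∏ i, P i (h i), fun h => Finset.prod_nonneg fun i _ => hP i _,
        fun i y => ?_, by simp⟩
      have e : ∀ h : I → X, (if h i = y then ∏ j, P j (h j) else 0) =
          ∏ j, if j = i then (if h j = y then P j (h j) else 0) else P j (h j) := by
        intro h
        by_cases hy : h i = y
        · rw [if_pos hy]
          refine Finset.prod_congr rfl fun j _ => ?_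
          by_cases hj : j = i
          · subst hj
            simp [hy]
          · simp [hj]
        · rw [if_neg hy]
          exact (Finset.prod_eq_zero (Finset.mem_univ i) (by simp [hy])).symm
      simp_rw [e]
      have h2 := Finset.prod_univ_sum (fun _ : I => (Finset.univ : Finset X))
        (fun j s => if j = i then (if s = y then P j s else 0) else P j s)
      rw [Fintype.piFinset_univ] at h2
      rw [← h2, Finset.prod_eq_single i]
      · simp
      · intro j _ hj
        simp [hj, hP1]
      · simp
    | insert e E _ ih =>
      intro hE
      obtain ⟨M, hM, hmarg, hmon⟩ := ih fun e he => hE e (Finset.mem_insert_of_mem he)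
      obtain ⟨u, v⟩ := e
      have huv : u ⋖ v := hE (u, v) (Finset.mem_insert_self _ _)
      obtain ⟨κ, hκ⟩ := hκ u v huv
      obtain ⟨V, hV⟩ := hI.exists_isCut huv
      let merge : (I → X) → (I → X) → I → X := fun h₁ h₂ i => if i ∈ V then h₂ i else h₁ i
      let W : (I → X) → (I → X) → ℝ := fun h₁ h₂ =>
        M h₁ * M h₂ * (κ (h₁ u) (h₂ v) / (P u (h₁ u) * P v (h₂ v)))
      have hW : ∀ h₁ h₂, 0 ≤ W h₁ h₂ := fun h₁ h₂ =>
        mul_nonneg (mul_nonneg (hM _) (hM _))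
          (div_nonneg (hκ.nonneg _ _) (mul_nonneg (hP _ _) (hP _ _)))
      have hpos : ∀ h i, M h ≠ 0 → P i (h i) ≠ 0 := by
        intro h i hh h0
        have h1 := hmarg i (h i)
        rw [h0] at h1
        have h2 := (Finset.sum_eq_zero_iff_of_nonneg (fun k _ => by
          split_ifs
          exacts [hM k, le_rfl])).1 h1 h (Finset.mem_univ h)
        simp at h2
        exact hh h2
      -- the conditional law of the value at `i`, given the value on the other side, has mass one
      have hnorm : ∀ (i : I) (f : X → ℝ) (p : ℝ), p ≠ 0 → ∑ s, f s = p →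
          (∀ s, P i s = 0 → f s = 0) → ∑ h, M h * (f (h i) / (p * P i (h i))) = 1 := by
        intro i f p hp hf hf0
        have e : ∀ h : I → X, M h * (f (h i) / (p * P i (h i))) =
            ∑ s, (if h i = s then M h else 0) * (f s / (p * P i s)) := by
          intro h
          rw [Finset.sum_eq_single (h i)] <;> simp +contextual [eq_comm]
        simp_rw [e]
        rw [Finset.sum_comm]
        simp_rw [← Finset.sum_mul, hmarg]
        have e2 : ∀ s, P i s * (f s / (p * P i s)) = f s / p := by
          intro s
          by_cases hs : P i s = 0
          · simp [hs, hf0 s hs]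
          · field_simp
        simp_rw [e2]
        rw [← Finset.sum_div, hf, div_self hp]
      have hright : ∀ h₁, ∑ h₂, W h₁ h₂ = M h₁ := by
        intro h₁
        by_cases h0 : M h₁ = 0
        · simp [W, h0]
        simp only [W, mul_assoc]
        rw [← Finset.mul_sum]
        rw [hnorm v (fun s => κ (h₁ u) s) _ (hpos h₁ u h0) (hκ.sum_right _), mul_one]
        intro s hs
        have h1 := hκ.sum_left s
        rw [hs] at h1
        exact (Finset.sum_eq_zero_iff_of_nonneg fun x _ => hκ.nonneg x s).1 h1 _
          (Finset.mem_univ _)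
      have hleft : ∀ h₂, ∑ h₁, W h₁ h₂ = M h₂ := by
        intro h₂
        by_cases h0 : M h₂ = 0
        · simp [W, h0]
        have e : ∀ h₁, W h₁ h₂ =
            M h₂ * (M h₁ * (κ (h₁ u) (h₂ v) / (P v (h₂ v) * P u (h₁ u)))) := by
          intro h₁
          simp only [W]
          rw [mul_comm (P u (h₁ u))]
          ring
        simp_rw [e]
        rw [← Finset.mul_sum]
        rw [hnorm u (fun s => κ s (h₂ v)) _ (hpos h₂ v h0) (hκ.sum_left _), mul_one]
        intro s hs
        have h1 := hκ.sum_right s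
        rw [hs] at h1
        exact (Finset.sum_eq_zero_iff_of_nonneg fun x _ => hκ.nonneg s x).1 h1 _
          (Finset.mem_univ _)
      refine ⟨fun h => ∑ h₁, ∑ h₂, if merge h₁ h₂ = h then W h₁ h₂ else 0, fun h => ?_,
        fun i y => ?_, fun h hh => ?_⟩
      · refine Finset.sum_nonneg fun h₁ _ => Finset.sum_nonneg fun h₂ _ => ?_
        split_ifs
        exacts [hW _ _, le_rfl]
      · have e : ∑ h : I → X, (if h i = y then
            ∑ h₁, ∑ h₂, (if merge h₁ h₂ = h then W h₁ h₂ else 0) else 0) =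
            ∑ h₁, ∑ h₂, if merge h₁ h₂ i = y then W h₁ h₂ else 0 := by
          have e1 : ∀ h : I → X, (if h i = y then
              ∑ h₁, ∑ h₂, (if merge h₁ h₂ = h then W h₁ h₂ else 0) else 0) =
              ∑ h₁, ∑ h₂, if merge h₁ h₂ = h then (if h i = y then W h₁ h₂ else 0) else 0 := by
            intro h
            split_ifs <;> simp
          simp_rw [e1]
          rw [Finset.sum_comm]
          refine Finset.sum_congr rfl fun h₁ _ => ?_
          rw [Finset.sum_comm]
          simp
        rw [e, ← hmarg i y]
        by_cases hi : i ∈ V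
        · rw [Finset.sum_comm]
          refine Finset.sum_congr rfl fun h₂ _ => ?_
          simp only [merge, if_pos hi]
          split_ifs
          · exact hleft h₂
          · simp
        · refine Finset.sum_congr rfl fun h₁ _ => ?_
          simp only [merge, if_neg hi]
          split_ifs
          · exact hright h₁
          · simp
      · obtain ⟨h₁, -, h1⟩ := Finset.exists_ne_zero_of_sum_ne_zero hh
        obtain ⟨h₂, -, h2⟩ := Finset.exists_ne_zero_of_sum_ne_zero h1
        by_cases hm : merge h₁ h₂ = h
        · rw [if_pos hm] at h2
          have hM₁ : M h₁ ≠ 0 := fun h0 => h2 (by simp [W, h0])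
          have hM₂ : M h₂ ≠ 0 := fun h0 => h2 (by simp [W, h0])
          have hk : κ (h₁ u) (h₂ v) ≠ 0 := fun h0 => h2 (by simp [W, h0])
          subst hm
          rintro ⟨a, b⟩ he
          dsimp only
          by_cases hab : a = u ∧ b = v
          · obtain ⟨rfl, rfl⟩ := hab
            simp only [merge, if_neg hV.bot_notMem, if_pos hV.top_mem]
            exact hκ.le_of_ne_zero _ _ hk
          · have he' : (a, b) ∈ E := by
              rcases Finset.mem_insert.1 he with h | h
              · exact absurd (Prod.ext_iff.1 h) hab
              · exact h
            have hiff := hV.mem_iff a b (hE _ he) (by tauto)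
            by_cases ha : a ∈ V
            · simp only [merge, if_pos ha, if_pos (hiff.1 ha)]
              exact hmon h₂ hM₂ _ he'
            · simp only [merge, if_neg ha, if_neg (hiff.not.1 ha)]
              exact hmon h₁ hM₁ _ he'
        · exact absurd (if_neg hm) h2
  obtain ⟨M, hM, hmarg, hmon⟩ := hind (Finset.univ.filter fun e : I × I => e.1 ⋖ e.2) (by simp)
  refine ⟨M, hM, hmarg, fun h hh i j hij => ?_⟩
  have := reflTransGen_covBy_of_le hij
  clear hij
  induction this with
  | refl => exact le_rfl
  | @tail b c _ hbc ih => exact ih.trans (hmon h hh (b, c) (by simpa using hbc))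

end Coupling

/-! ### Interpolation between stochastically ordered families -/

section Interpolation

open scoped Classical

/-- Interpolation between the families `P` and `Q` on a connected acyclic poset. The mass of
the interpolating measure on each cut `V u v` is either the largest of the masses `P i (V u v)`,
if `ρ u` holds, or the smallest of the masses `Q j (V u v)`. Such a measure exists as a signed
one; the conditions on `ρ` make it nonnegative except possibly at the vertex `c`. There it is
nonnegative because the branches at `c` carry little mass. -/
lemma exists_interpolation {T ι ι' : Type*} [PartialOrder T] [Fintype T] [Finite ι] [Nonempty ι]
    [Finite ι'] [Nonempty ι']
    (hT : (SimpleGraph.hasse T).Preconnected) {V : T → T → Set T}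
    (hV : ∀ u v, u ⋖ v → IsCut u v (V u v)) (P : ι → T → ℝ) (Q : ι' → T → ℝ)
    (hP : ∀ i x, 0 ≤ P i x) (hQ : ∀ j x, 0 ≤ Q j x) {N : ℝ} (hPN : ∀ i, ∑ x, P i x = N)
    (hQN : ∀ j, ∑ x, Q j x = N)
    (hPQ : ∀ i j u v, u ⋖ v → ∑ z, (V u v).indicator (P i) z ≤ ∑ z, (V u v).indicator (Q j) z)
    (c : T) (ρ : T → Prop)
    (htop : ∀ x ≠ c, ρ x → ∀ v v', x ⋖ v → x ⋖ v' → v = v')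
    (hbot : ∀ x ≠ c, ¬ ρ x → ∀ u u', u ⋖ x → u' ⋖ x → u = u')
    (hup : ∀ u x, u ⋖ x → x ≠ c → ρ u → ρ x) {ε : ℝ} (hε0 : 0 ≤ ε)
    (hε : 2 * Fintype.card T * ε ≤ N)
    (hlow : ∀ k, k ⋖ c → ∃ i, N - ε ≤ ∑ z, (V k c).indicator (P i) z)
    (hupp : ∀ l, c ⋖ l → ∃ j, ∑ z, (V c l).indicator (Q j) z ≤ ε) :
    ∃ R : T → ℝ, (∀ x, 0 ≤ R x) ∧ ∑ x, R x = N ∧ ∀ u v, u ⋖ v →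
      (∀ i, ∑ z, (V u v).indicator (P i) z ≤ ∑ z, (V u v).indicator R z) ∧
      ∀ j, ∑ z, (V u v).indicator R z ≤ ∑ z, (V u v).indicator (Q j) z := by
  choose imax himax using fun u v : T =>
    Finite.exists_max fun i => ∑ z, (V u v).indicator (P i) z
  choose jmin hjmin using fun u v : T =>
    Finite.exists_min fun j => ∑ z, (V u v).indicator (Q j) z
  let r : T → T → ℝ := fun u v => if ρ u then ∑ z, (V u v).indicator (P (imax u v)) z else
    ∑ z, (V u v).indicator (Q (jmin u v)) z
  have hrP : ∀ u v, u ⋖ v → ∀ i, ∑ z, (V u v).indicator (P i) z ≤ r u v := by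
    intro u v huv i
    simp only [r]
    split_ifs
    · exact himax u v i
    · exact hPQ i _ u v huv
  have hrQ : ∀ u v, u ⋖ v → ∀ j, r u v ≤ ∑ z, (V u v).indicator (Q j) z := by
    intro u v huv j
    simp only [r]
    split_ifs
    · exact hPQ _ j u v huv
    · exact hjmin u v j
  let i₀ : ι := Classical.arbitrary ι
  let j₀ : ι' := Classical.arbitrary ι'
  let w : T → T → ℝ := fun u v =>
    if u ⋖ v then r u v - ∑ z, (V u v).indicator (P i₀) z else 0
  let R : T → ℝ := fun x => P i₀ x + ∑ u, w u x - ∑ v, w x v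
  -- the reference measure `P i₀` may be replaced by any other of total mass `N`
  have hR : ∀ D : T → ℝ, ∑ x, D x = N → ∀ x, R x = D x +
      ∑ u, (if u ⋖ x then r u x - ∑ z, (V u x).indicator D z else 0) -
      ∑ v, (if x ⋖ v then r x v - ∑ z, (V x v).indicator D z else 0) := by
    intro D hD x
    have h1 := eq_sum_mass_cut hT hV (fun z => D z - P i₀ z)
      (by rw [Finset.sum_sub_distrib, hD, hPN, sub_self]) x
    have e : ∀ u v, ∑ z, (V u v).indicator (fun z => D z - P i₀ z) z =
        ∑ z, (V u v).indicator D z - ∑ z, (V u v).indicator (P i₀) z := by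
      intro u v
      rw [← Finset.sum_sub_distrib]
      exact Finset.sum_congr rfl fun z _ => congrFun (Set.indicator_sub (V u v) D (P i₀)) z
    simp only [e] at h1
    have e1 : ∀ u, w u x = (if u ⋖ x then r u x - ∑ z, (V u x).indicator D z else 0) +
        if u ⋖ x then ∑ z, (V u x).indicator D z - ∑ z, (V u x).indicator (P i₀) z else 0 := by
      intro u
      simp only [w]
      split_ifs <;> ring
    have e2 : ∀ v, w x v = (if x ⋖ v then r x v - ∑ z, (V x v).indicator D z else 0) +
        if x ⋖ v then ∑ z, (V x v).indicator D z - ∑ z, (V x v).indicator (P i₀) z else 0 := by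
      intro u
      simp only [w]
      split_ifs <;> ring
    simp only [R, e1, e2, Finset.sum_add_distrib]
    linarith
  have hRsum : ∀ φ : T → ℝ, ∑ x, φ x * R x =
      ∑ x, φ x * P i₀ x + ∑ u, ∑ v, w u v * (φ v - φ u) := by
    intro φ
    simp only [R, mul_sub, mul_add, Finset.sum_sub_distrib, Finset.sum_add_distrib,
      Finset.mul_sum]
    rw [Finset.sum_comm (f := fun x i => φ x * w i x)]
    simp only [mul_comm (φ _) (w _ _)]
    ring
  have hind : ∀ (W : Set T) (D : T → ℝ),
      ∑ z, W.indicator D z = ∑ z, W.indicator (fun _ => (1 : ℝ)) z * D z := by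
    intro W D
    refine Finset.sum_congr rfl fun z _ => ?_
    by_cases hz : z ∈ W <;> simp [hz]
  have hRcut : ∀ a b, a ⋖ b → ∑ z, (V a b).indicator R z = r a b := by
    intro a b hab
    have hc := hV a b hab
    have h0 : ∑ u, ∑ v, w u v * ((V a b).indicator (fun _ => (1 : ℝ)) v -
        (V a b).indicator (fun _ => (1 : ℝ)) u) = w a b := by
      rw [Finset.sum_eq_single a, Finset.sum_eq_single b]
      · simp [hc.bot_notMem, hc.top_mem]
      · intro v _ hv
        by_cases h : a ⋖ v
        · have h1 := (hc.mem_iff a v h (Or.inr hv)).not.1 hc.bot_notMem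
          simp [hc.bot_notMem, h1]
        · simp [w, h]
      · simp
      · intro u _ hu
        refine Finset.sum_eq_zero fun v _ => ?_
        by_cases h : u ⋖ v
        · have h1 := hc.mem_iff u v h (Or.inl hu)
          by_cases h2 : u ∈ V a b
          · simp [h2, h1.1 h2]
          · simp [h2, h1.not.1 h2]
        · simp [w, h]
      · simp
    rw [hind, hRsum, ← hind, h0]
    simp only [w, if_pos hab]
    ring
  refine ⟨R, fun x => ?_, ?_, fun u v huv => ⟨fun i => ?_, fun j => ?_⟩⟩
  · by_cases hx : x = c
    · subst hx
      rw [hR (fun z => if z = x then N else 0) (by simp)]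
      have h1 : -(Fintype.card T * ε) ≤ ∑ u, (if u ⋖ x then r u x -
          ∑ z, (V u x).indicator (fun z => if z = x then N else 0) z else 0) := by
        have : ∑ _u : T, -ε ≤ ∑ u, (if u ⋖ x then r u x -
            ∑ z, (V u x).indicator (fun z => if z = x then N else 0) z else 0) := by
          refine Finset.sum_le_sum fun u _ => ?_
          split_ifs with hu
          · have e : ∑ z, (V u x).indicator (fun z => if z = x then N else 0) z = N := by
              rw [Finset.sum_eq_single x]
              · simp [(hV u x hu).top_mem]
              · intro z _ hz
                simp [hz]
              · simp
            obtain ⟨i, hi⟩ := hlow u hu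
            have := hrP u x hu i
            linarith
          · linarith
        simpa using this
      have h2 : ∑ v, (if x ⋖ v then r x v -
          ∑ z, (V x v).indicator (fun z => if z = x then N else 0) z else 0) ≤
          Fintype.card T * ε := by
        have : ∑ v, (if x ⋖ v then r x v -
            ∑ z, (V x v).indicator (fun z => if z = x then N else 0) z else 0) ≤
            ∑ _v : T, ε := by
          refine Finset.sum_le_sum fun v _ => ?_
          split_ifs with hv
          · have e : ∑ z, (V x v).indicator (fun z => if z = x then N else 0) z = 0 := by
              refine Finset.sum_eq_zero fun z _ => ?_
              by_cases hz : z = x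
              · subst hz
                simp [(hV z v hv).bot_notMem]
              · simp [hz]
            obtain ⟨j, hj⟩ := hupp v hv
            have := hrQ x v hv j
            linarith
          · exact hε0
        simpa using this
      rw [if_pos rfl]
      linarith
    · by_cases hρ : ρ x
      · -- there is at most one edge upwards, on which some `P i` has the prescribed mass
        have key : ∃ i, ∀ v, x ⋖ v → r x v = ∑ z, (V x v).indicator (P i) z := by
          by_cases hex : ∃ v, x ⋖ v
          · obtain ⟨v, hv⟩ := hex
            refine ⟨imax x v, fun v' hv' => ?_⟩
            rw [htop x hx hρ v' v hv' hv]
            simp only [r, if_pos hρ]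
          · exact ⟨i₀, fun v hv => absurd ⟨v, hv⟩ hex⟩
        obtain ⟨i, hi⟩ := key
        rw [hR (P i) (hPN i)]
        have h1 : 0 ≤ ∑ u, (if u ⋖ x then r u x - ∑ z, (V u x).indicator (P i) z else 0) := by
          refine Finset.sum_nonneg fun u _ => ?_
          split_ifs with hu
          exacts [sub_nonneg.2 (hrP u x hu i), le_rfl]
        have h2 : ∑ v, (if x ⋖ v then r x v - ∑ z, (V x v).indicator (P i) z else 0) = 0 := by
          refine Finset.sum_eq_zero fun v _ => ?_
          split_ifs with hv
          exacts [sub_eq_zero.2 (hi v hv), rfl]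
        have := hP i x
        linarith
      · -- there is at most one edge downwards, on which some `Q j` has the prescribed mass
        have key : ∃ j, ∀ u, u ⋖ x → r u x = ∑ z, (V u x).indicator (Q j) z := by
          by_cases hex : ∃ u, u ⋖ x
          · obtain ⟨u, hu⟩ := hex
            refine ⟨jmin u x, fun u' hu' => ?_⟩
            rw [hbot x hx hρ u' u hu' hu]
            simp only [r, if_neg fun h => hρ (hup u x hu hx h)]
          · exact ⟨j₀, fun u hu => absurd ⟨u, hu⟩ hex⟩
        obtain ⟨j, hj⟩ := key
        rw [hR (Q j) (hQN j)]
        have h1 : ∑ u, (if u ⋖ x then r u x - ∑ z, (V u x).indicator (Q j) z else 0) = 0 := by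
          refine Finset.sum_eq_zero fun u _ => ?_
          split_ifs with hu
          exacts [sub_eq_zero.2 (hj u hu), rfl]
        have h2 : ∑ v, (if x ⋖ v then r x v - ∑ z, (V x v).indicator (Q j) z else 0) ≤ 0 := by
          refine Finset.sum_nonpos fun v _ => ?_
          split_ifs with hv
          exacts [sub_nonpos.2 (hrQ x v hv j), le_rfl]
        have := hQ j x
        linarith
  · have h1 := hRsum fun _ => 1
    simpa [hPN] using h1
  · rw [hRcut u v huv]
    exact hrP u v huv i
  · rw [hRcut u v huv]
    exact hrQ u v huv j

end Interpolation

/-! ### The branches at a vertex -/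

section Pieces

variable {T : Type*} [PartialOrder T]

/-- The union of the branches at `c` that are attached to `c` from below. -/
def lowerBranches (c : T) : Set T := {z | ∃ k V, k ⋖ c ∧ IsCut k c V ∧ z ∉ V}

/-- The union of the branches at `c` that are attached to `c` from above. -/
def upperBranches (c : T) : Set T := {z | ∃ l V, c ⋖ l ∧ IsCut c l V ∧ z ∈ V}

variable {c : T}

lemma toDual_mem_lowerBranches {z : T} (hz : z ∈ upperBranches c) :
    OrderDual.toDual z ∈ lowerBranches (OrderDual.toDual c) := by
  obtain ⟨l, V, hl, hV, hzV⟩ := hz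
  exact ⟨_, _, hl.toDual, hV.dual, fun h => h hzV⟩

lemma notMem_lowerBranches_self : c ∉ lowerBranches c := by
  rintro ⟨k, V, -, hV, hc⟩
  exact hc hV.top_mem

lemma notMem_upperBranches_self : c ∉ upperBranches c := by
  rintro ⟨k, V, -, hV, hc⟩
  exact hV.bot_notMem hc

lemma isLowerSet_lowerBranches [Finite T] : IsLowerSet (lowerBranches c) := by
  rintro x y hyx ⟨k, V, hk, hV, hx⟩
  exact ⟨k, V, hk, hV, fun hy => hx (hV.isUpperSet hk hyx hy)⟩

lemma isUpperSet_upperBranches [Finite T] : IsUpperSet (upperBranches c) := by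
  rintro x y hyx ⟨k, V, hk, hV, hx⟩
  exact ⟨k, V, hk, hV, hV.isUpperSet hk hyx hx⟩

lemma AcyclicPoset.mem_lowerBranches_of_lt [Finite T] (hT : AcyclicPoset T) {x : T}
    (hx : x < c) : x ∈ lowerBranches c := by
  obtain ⟨k, hxk, hk⟩ := exists_le_bot_covBy hx
  obtain ⟨V, hV⟩ := hT.exists_isCut hk
  exact ⟨k, V, hk, hV, fun h => hV.bot_notMem (hV.isUpperSet hk hxk h)⟩

lemma AcyclicPoset.mem_upperBranches_of_lt [Finite T] (hT : AcyclicPoset T) {x : T}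
    (hx : c < x) : x ∈ upperBranches c := by
  obtain ⟨l, hl, hlx⟩ := exists_covBy_top_le hx
  obtain ⟨V, hV⟩ := hT.exists_isCut hl
  exact ⟨l, V, hl, hV, hV.isUpperSet hl hlx hV.top_mem⟩

lemma mem_lowerBranches_of_covBy {x y : T} (hxy : x ⋖ y) (hx : x ∈ lowerBranches c) :
    y = c ∨ y ∈ lowerBranches c := by
  obtain ⟨k, V, hk, hV, hxV⟩ := hx
  by_cases h : x = k ∧ y = c
  · exact Or.inl h.2
  · exact Or.inr ⟨k, V, hk, hV, (hV.mem_iff x y hxy (by tauto)).not.1 hxV⟩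

lemma mem_upperBranches_of_covBy {x y : T} (hxy : x ⋖ y) (hy : y ∈ upperBranches c) :
    x = c ∨ x ∈ upperBranches c := by
  obtain ⟨l, V, hl, hV, hyV⟩ := hy
  by_cases h : x = c ∧ y = l
  · exact Or.inl h.1
  · exact Or.inr ⟨l, V, hl, hV, (hV.mem_iff x y hxy (by tauto)).2 hyV⟩

lemma disjoint_lowerBranches_upperBranches (hT : (SimpleGraph.hasse T).Preconnected) :
    Disjoint (lowerBranches c) (upperBranches c) := by
  rw [Set.disjoint_left]
  rintro z ⟨k, V, hk, hV, hz⟩ ⟨l, V', hl, hV', hz'⟩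
  exact hz (hV.mem_of_mem_of_covBy hT hV' hk hl hz')

lemma AcyclicPoset.mem_branches [Finite T] (hac : AcyclicPoset T)
    (hT : (SimpleGraph.hasse T).Preconnected) (z : T) :
    z = c ∨ z ∈ lowerBranches c ∨ z ∈ upperBranches c := by
  have hW : IsUncrossed {z | z = c ∨ z ∈ lowerBranches c ∨ z ∈ upperBranches c} := by
    intro x y hxy
    constructor
    · rintro (rfl | hx | hx)
      · exact Or.inr (Or.inr (hac.mem_upperBranches_of_lt hxy.lt))
      · rcases mem_lowerBranches_of_covBy hxy hx with h | h
        exacts [Or.inl h, Or.inr (Or.inl h)]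
      · exact Or.inr (Or.inr (isUpperSet_upperBranches hxy.le hx))
    · rintro (rfl | hy | hy)
      · exact Or.inr (Or.inl (hac.mem_lowerBranches_of_lt hxy.lt))
      · exact Or.inr (Or.inl (isLowerSet_lowerBranches hxy.le hy))
      · rcases mem_upperBranches_of_covBy hxy hy with h | h
        exacts [Or.inl h, Or.inr (Or.inr h)]
  exact hW.mem_of_mem hT (x := c) (Or.inl rfl) z

end Pieces

/-! ### Realizability on Y-glued bipartite posets -/

namespace BipartiteSub

open Extension

variable {S : Type*} [PartialOrder S] (A : BipartiteSub S)

/-- The extension has one vertex more than `S`. -/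
def extensionEquivOption : A.Extension ≃ Option S where
  toFun
    | center => none
    | vertex x => some x
  invFun
    | none => center
    | some x => vertex x
  left_inv u := by cases u <;> rfl
  right_inv u := by cases u <;> rfl

instance instFintypeExtension [Fintype S] : Fintype A.Extension :=
  Fintype.ofEquiv _ A.extensionEquivOption.symm

lemma sum_extension [Fintype S] (f : A.Extension → ℝ) :
    ∑ z, f z = f center + ∑ s, f (vertex s) := by
  rw [← Equiv.sum_comp A.extensionEquivOption.symm f, Fintype.sum_option]
  rfl

variable {A}

lemma vertex_le_vertex {x y : S} : (vertex x : A.Extension) ≤ vertex y ↔ x ≤ y := Iff.rfl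

lemma vertex_le_center {x : S} : (vertex x : A.Extension) ≤ center ↔ ∃ a ∈ A.lower, x ≤ a :=
  Iff.rfl

lemma center_le_vertex {y : S} : (center : A.Extension) ≤ vertex y ↔ ∃ b ∈ A.upper, b ≤ y :=
  Iff.rfl

lemma vertex_lt_vertex {x y : S} : (vertex x : A.Extension) < vertex y ↔ x < y := by
  rw [lt_iff_le_not_ge, lt_iff_le_not_ge, vertex_le_vertex, vertex_le_vertex]

lemma vertex_lt_center {x : S} : (vertex x : A.Extension) < center ↔ ∃ a ∈ A.lower, x ≤ a := by
  rw [lt_iff_le_and_ne, vertex_le_center]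
  exact and_iff_left (by simp)

lemma center_lt_vertex {y : S} : (center : A.Extension) < vertex y ↔ ∃ b ∈ A.upper, b ≤ y := by
  rw [lt_iff_le_and_ne, center_le_vertex]
  exact and_iff_left (by simp)

lemma eq_of_le_of_mem_lower {a a' : S} (ha : a ∈ A.lower) (ha' : a' ∈ A.lower) (h : a ≤ a') :
    a = a' := by
  obtain ⟨b, hb⟩ := A.upper_nontrivial.nonempty
  exact eq_of_le_of_not_lt h fun hlt => (A.covBy a ha b hb).2 hlt (A.covBy a' ha' b hb).lt

lemma eq_of_le_of_mem_upper {b b' : S} (hb : b ∈ A.upper) (hb' : b' ∈ A.upper) (h : b ≤ b') :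
    b = b' := by
  obtain ⟨a, ha⟩ := A.lower_nontrivial.nonempty
  exact eq_of_le_of_not_lt h fun hlt => (A.covBy a ha b' hb').2 (A.covBy a ha b hb).lt hlt

open scoped Classical in
/-- A stochastically monotone generator on `S` is realizable if the extension by `center` is a
connected acyclic poset whose parts below and above `center` contain no bowtie. A row for `center`
is interpolated between those of the lower and of the upper vertices, which yields a
stochastically monotone family indexed by an acyclic poset; the restriction to `S` of a random
monotone map with these laws never takes the value `center`. -/
theorem rateRealizable_of_extension [Fintype S] (hac : AcyclicPoset A.Extension)
    (hT : (SimpleGraph.hasse A.Extension).Preconnected)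
    (hlow : ¬ HasInducedBowtie ↥(insert center (lowerBranches (center : A.Extension))))
    (hupp : ¬ HasInducedBowtie ↥(insert center (upperBranches (center : A.Extension))))
    {L : Matrix S S ℝ} (hL : IsGenerator L) (hst : StochasticallyMonotone (transition L)) :
    RateRealizable L := by
  choose! V hV using fun (u v : A.Extension) (h : u ⋖ v) => hac.exists_isCut h
  have hVup : ∀ u v, u ⋖ v → IsUpperSet (V u v) := fun u v h => (hV u v h).isUpperSet h
  set ε : ℝ := ∑ x, ∑ y, |L x y| + 1 with hεdef
  have hε1 : 1 ≤ ε := by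
    have : 0 ≤ ∑ x, ∑ y, |L x y| :=
      Finset.sum_nonneg fun x _ => Finset.sum_nonneg fun y _ => abs_nonneg _
    linarith
  -- the rows receive a large mass `N` on the diagonal; it makes them nonnegative, orders their
  -- masses on up-sets that separate the indices, and leaves room at `center`
  set N : ℝ := 2 * Fintype.card A.Extension * ε with hNdef
  have hN2 : 2 * ε ≤ N := by
    have : (1 : ℝ) ≤ Fintype.card A.Extension := by
      exact_mod_cast Fintype.card_pos_iff.2 ⟨center⟩
    nlinarith
  have hNpos : 0 < N := by linarith
  let ell : S → A.Extension → ℝ := fun s z =>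
    match z with
    | center => 0
    | vertex y => L s y
  have hell : ∀ s (W : Set A.Extension),
      ∑ z, W.indicator (ell s) z = ∑ y, (vertex ⁻¹' W).indicator (L s) y := by
    intro s W
    rw [sum_extension]
    have : W.indicator (ell s) center = 0 := by
      by_cases h : (center : A.Extension) ∈ W <;> simp [h, ell]
    rw [this, zero_add]
    rfl
  have hbound : ∀ s (W : Set A.Extension), |∑ z, W.indicator (ell s) z| ≤ ε := by
    intro s W
    rw [hell]
    refine (Finset.abs_sum_le_sum_abs _ _).trans ?_
    have h1 : ∑ y, |(vertex ⁻¹' W).indicator (L s) y| ≤ ∑ y, |L s y| := by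
      refine Finset.sum_le_sum fun y _ => ?_
      by_cases h : y ∈ (vertex ⁻¹' W : Set S)
      · simp [Set.indicator_of_mem h]
      · simp [Set.indicator_of_notMem h]
    have h2 : ∑ y, |L s y| ≤ ∑ x, ∑ y, |L x y| :=
      Finset.single_le_sum (f := fun x => ∑ y, |L x y|)
        (fun x _ => Finset.sum_nonneg fun y _ => abs_nonneg _) (Finset.mem_univ s)
    linarith
  let row : S → A.Extension → ℝ := fun s z => (if z = vertex s then N else 0) + ell s z
  have hrow : ∀ s (W : Set A.Extension), ∑ z, W.indicator (row s) z =
      (if vertex s ∈ W then N else 0) + ∑ z, W.indicator (ell s) z := by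
    intro s W
    have e : ∀ z, W.indicator (row s) z =
        (if z = vertex s then (if vertex s ∈ W then N else 0) else 0) + W.indicator (ell s) z := by
      intro z
      by_cases hz : z ∈ W
      · by_cases h : z = vertex s
        · subst h
          simp [hz, row]
        · simp [hz, row, h]
      · by_cases h : z = vertex s
        · subst h
          simp [hz]
        · simp [hz, h]
    simp_rw [e, Finset.sum_add_distrib]
    simp
  have hrow0 : ∀ s z, 0 ≤ row s z := by
    intro s z
    cases z with
    | center => simp [row, ell]
    | vertex y =>
      by_cases h : s = y
      · subst h
        have h1 := hbound s {vertex s}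
        have h2 : ∑ z, ({vertex s} : Set A.Extension).indicator (ell s) z = L s s := by
          rw [Finset.sum_eq_single (vertex s)]
          · simp [ell]
          · intro z _ hz
            simp [hz]
          · simp
        rw [h2] at h1
        have h3 := neg_abs_le (L s s)
        simp only [row, ell, if_true]
        linarith
      · have h' : (vertex y : A.Extension) ≠ vertex s := fun e =>
          h (by injection e with e; exact e.symm)
        simp only [row, ell, if_neg h', zero_add]
        exact hL.nonneg s y h
  have hrowN : ∀ s, ∑ z, row s z = N := by
    intro s
    have h1 := hrow s Set.univ
    rw [hell] at h1
    simpa [hL.row_sum s] using h1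
  have hrowle : ∀ s t, s ≤ t → ∀ W : Set A.Extension, IsUpperSet W →
      ∑ z, W.indicator (row s) z ≤ ∑ z, W.indicator (row t) z := by
    intro s t hst' W hW
    rw [hrow, hrow]
    by_cases hs : (vertex s : A.Extension) ∈ W
    · have ht : (vertex t : A.Extension) ∈ W := hW (vertex_le_vertex.2 hst') hs
      rw [if_pos hs, if_pos ht, hell, hell]
      have := hst.sum_le hst' (U := vertex ⁻¹' W) (fun a b hab ha => hW (vertex_le_vertex.2 hab) ha)
        (iff_of_true hs ht)
      linarith
    · rw [if_neg hs]
      by_cases ht : (vertex t : A.Extension) ∈ W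
      · rw [if_pos ht]
        have h1 := (abs_le.1 (hbound s W)).2
        have h2 := (abs_le.1 (hbound t W)).1
        linarith
      · rw [if_neg ht, hell, hell]
        have := hst.sum_le hst' (U := vertex ⁻¹' W)
          (fun a b hab ha => hW (vertex_le_vertex.2 hab) ha) (iff_of_false hs ht)
        linarith
  obtain ⟨R, hR0, hRN, hR⟩ : ∃ R : A.Extension → ℝ, (∀ x, 0 ≤ R x) ∧ ∑ x, R x = N ∧
      ∀ u v, u ⋖ v →
        (∀ i : {s : S // (vertex s : A.Extension) < center},
          ∑ z, (V u v).indicator (row i.1) z ≤ ∑ z, (V u v).indicator R z) ∧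
        ∀ j : {s : S // (center : A.Extension) < vertex s},
          ∑ z, (V u v).indicator R z ≤ ∑ z, (V u v).indicator (row j.1) z := by
    have hnel : Nonempty {s : S // (vertex s : A.Extension) < center} := by
      obtain ⟨a, ha⟩ := A.lower_nontrivial.nonempty
      exact ⟨a, vertex_lt_center.2 ⟨a, ha, le_rfl⟩⟩
    have hneu : Nonempty {s : S // (center : A.Extension) < vertex s} := by
      obtain ⟨a, ha⟩ := A.upper_nontrivial.nonempty
      exact ⟨a, center_lt_vertex.2 ⟨a, ha, le_rfl⟩⟩
    have hdisj := Set.disjoint_left.1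
      (disjoint_lowerBranches_upperBranches (c := (center : A.Extension)) hT)
    -- `ρ x` says that two incomparable elements lie below `x` in the piece of `x`; where it fails,
    -- there is at most one edge downwards, and where it holds, at most one edge upwards
    refine exists_interpolation hT hV (fun i : {s : S // (vertex s : A.Extension) < center} =>
      row i.1) (fun j : {s : S // (center : A.Extension) < vertex s} => row j.1)
      (fun i => hrow0 _) (fun j => hrow0 _) (fun i => hrowN _) (fun j => hrowN _)
      (fun i j u v huv => hrowle _ _ (vertex_le_vertex.1 (i.2.trans j.2).le) _ (hVup u v huv))
      center (fun x => ∃ p q, p ≤ x ∧ q ≤ x ∧ ¬ p ≤ q ∧ ¬ q ≤ p ∧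
        (x ∈ insert center (upperBranches (center : A.Extension)) →
          p ∈ insert center (upperBranches (center : A.Extension)) ∧
          q ∈ insert center (upperBranches (center : A.Extension))))
      ?_ ?_ ?_ (by linarith) le_rfl ?_ ?_
    · -- a second edge upwards would complete a bowtie
      rintro x hxc ⟨p, q, hpx, hqx, hpq, hqp, hpiece⟩ v v' hv hv'
      by_contra hne
      have hvv' : ¬ v ≤ v' := fun h =>
        hne (eq_of_le_of_not_lt h fun hlt => hv'.2 hv.lt hlt)
      have hv'v : ¬ v' ≤ v := fun h =>
        hne (eq_of_le_of_not_lt h fun hlt => hv.2 hv'.lt hlt).symm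
      rcases hac.mem_branches hT x with h | h | h
      · exact hxc h
      · have hmem : ∀ y, y ≤ x → y ∈ insert center (lowerBranches (center : A.Extension)) :=
          fun y hy => Or.inr (isLowerSet_lowerBranches hy h)
        exact hlow ⟨⟨p, hmem p hpx⟩, ⟨q, hmem q hqx⟩, ⟨v, mem_lowerBranches_of_covBy hv h⟩,
          ⟨v', mem_lowerBranches_of_covBy hv' h⟩, hpx.trans_lt hv.lt, hpx.trans_lt hv'.lt,
          hqx.trans_lt hv.lt, hqx.trans_lt hv'.lt, hpq, hqp, hvv', hv'v⟩
      · obtain ⟨hp, hq⟩ := hpiece (Or.inr h)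
        have hmem : ∀ y, x ≤ y → y ∈ insert center (upperBranches (center : A.Extension)) :=
          fun y hy => Or.inr (isUpperSet_upperBranches hy h)
        exact hupp ⟨⟨p, hp⟩, ⟨q, hq⟩, ⟨v, hmem v hv.le⟩,
          ⟨v', hmem v' hv'.le⟩, hpx.trans_lt hv.lt, hpx.trans_lt hv'.lt,
          hqx.trans_lt hv.lt, hqx.trans_lt hv'.lt, hpq, hqp, hvv', hv'v⟩
    · intro x hxc hx u u' hu hu'
      by_contra hne
      refine hx ⟨u, u', hu.le, hu'.le, fun h => hne (eq_of_le_of_not_lt h fun hlt =>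
        hu.2 hlt hu'.lt), fun h => hne (eq_of_le_of_not_lt h fun hlt =>
        hu'.2 hlt hu.lt).symm, ?_⟩
      rintro (h | h)
      · exact absurd h hxc
      · exact ⟨mem_upperBranches_of_covBy hu h, mem_upperBranches_of_covBy hu' h⟩
    · rintro u x hux hxc ⟨p, q, hpx, hqx, hpq, hqp, hpiece⟩
      refine ⟨p, q, hpx.trans hux.le, hqx.trans hux.le, hpq, hqp, ?_⟩
      rintro (h | h)
      · exact absurd h hxc
      · exact hpiece (mem_upperBranches_of_covBy hux h)
    · -- the row of a lower vertex other than `k` has nearly all its mass on the upper side of the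
      -- edge `k ⋖ center`
      intro k hk
      cases k with
      | center => exact absurd hk.lt (lt_irrefl _)
      | vertex k =>
        obtain ⟨a₀, ha₀, hka₀⟩ := vertex_lt_center.1 hk.lt
        obtain ⟨a, ha, hne⟩ := A.lower_nontrivial.exists_ne a₀
        have hac' : (vertex a : A.Extension) < center := vertex_lt_center.2 ⟨a, ha, le_rfl⟩
        refine ⟨⟨a, hac'⟩, ?_⟩
        have haV : (vertex a : A.Extension) ∈ V (vertex k) center := by
          by_contra h
          have h1 := ((hV _ _ hk).le_of_notMem_of_mem hac'.le h (hV _ _ hk).top_mem).1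
          exact hne (eq_of_le_of_mem_lower ha ha₀ ((vertex_le_vertex.1 h1).trans hka₀))
        dsimp only
        rw [hrow, if_pos haV]
        have := (abs_le.1 (hbound a (V (vertex k) center))).1
        linarith
    · intro l hl
      cases l with
      | center => exact absurd hl.lt (lt_irrefl _)
      | vertex l =>
        obtain ⟨b₀, hb₀, hlb₀⟩ := center_lt_vertex.1 hl.lt
        obtain ⟨b, hb, hne⟩ := A.upper_nontrivial.exists_ne b₀
        have hbc : (center : A.Extension) < vertex b := center_lt_vertex.2 ⟨b, hb, le_rfl⟩
        refine ⟨⟨b, hbc⟩, ?_⟩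
        have hbV : (vertex b : A.Extension) ∉ V center (vertex l) := by
          intro h
          have h1 := ((hV _ _ hl).le_of_notMem_of_mem hbc.le (hV _ _ hl).bot_notMem h).2
          exact hne (eq_of_le_of_mem_upper hb₀ hb (hlb₀.trans (vertex_le_vertex.1 h1))).symm
        dsimp only
        rw [hrow, if_neg hbV]
        have := (abs_le.1 (hbound b (V center (vertex l)))).2
        linarith
  let full : A.Extension → A.Extension → ℝ := fun x =>
    match x with
    | center => R
    | vertex s => row s
  have hfull0 : ∀ x z, 0 ≤ full x z := by
    intro x z
    cases x with
    | center => exact hR0 z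
    | vertex s => exact hrow0 s z
  have hfullN : ∀ x, ∑ z, full x z = N := by
    intro x
    cases x with
    | center => exact hRN
    | vertex s => exact hrowN s
  have hcouple : ∀ x y, x ⋖ y →
      ∃ κ, IsMonotoneCoupling (fun z => full x z / N) (fun z => full y z / N) κ := by
    intro x y hxy
    have hle : ∀ u v, u ⋖ v →
        ∑ z, (V u v).indicator (full x) z ≤ ∑ z, (V u v).indicator (full y) z := by
      intro u v huv
      cases x with
      | center =>
        cases y with
        | center => exact le_rfl
        | vertex t => exact (hR u v huv).2 ⟨t, hxy.lt⟩
      | vertex s =>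
        cases y with
        | center => exact (hR u v huv).1 ⟨s, hxy.lt⟩
        | vertex t => exact hrowle s t (vertex_le_vertex.1 hxy.le) _ (hVup u v huv)
    obtain ⟨κ, hκ⟩ := exists_isMonotoneCoupling_of_cut_le hT hV (full x) (full y) (hfull0 x)
      (hfull0 y) ((hfullN x).trans (hfullN y).symm) hle
    refine ⟨fun a b => κ a b / N, fun a b => div_nonneg (hκ.nonneg a b) hNpos.le, fun a => ?_,
      fun b => ?_, fun a b h => hκ.le_of_ne_zero a b fun h0 => h (by simp [h0])⟩
    · rw [← Finset.sum_div, hκ.sum_right]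
    · rw [← Finset.sum_div, hκ.sum_left]
  obtain ⟨M, hM, hmarg, hmono⟩ := exists_law_of_coupling hac (fun x z => full x z / N)
    (fun x z => div_nonneg (hfull0 x z) hNpos.le)
    (fun x => by rw [← Finset.sum_div, hfullN, div_self hNpos.ne']) hcouple
  -- a map of positive mass does not send `vertex s` to `center`, which has mass zero in `row s`,
  -- so that it restricts to a monotone map on `S`
  refine ⟨fun φ => ∑ h, if ∀ s, h (vertex s) = vertex (φ s) then N * M h else 0, fun φ =>
    Finset.sum_nonneg fun h _ => ?_, fun x y hxy => ?_⟩
  · split_ifs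
    exacts [mul_nonneg hNpos.le (hM h), le_rfl]
  · have e : ∀ φ : S →o S, (if φ x = y then
        ∑ h : A.Extension → A.Extension,
          (if ∀ s, h (vertex s) = vertex (φ s) then N * M h else 0) else 0) =
        ∑ h : A.Extension → A.Extension, if φ x = y then
          (if ∀ s, h (vertex s) = vertex (φ s) then N * M h else 0) else 0 := by
      intro φ
      split_ifs <;> simp
    simp_rw [e]
    rw [Finset.sum_comm]
    have e2 : ∀ h : A.Extension → A.Extension, ∑ φ : S →o S, (if φ x = y then
          (if ∀ s, h (vertex s) = vertex (φ s) then N * M h else 0) else 0) =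
        N * if h (vertex x) = vertex y then M h else 0 := by
      intro h
      by_cases h0 : M h = 0
      · simp [h0]
      have hval : ∀ s, ∃ t, h (vertex s) = vertex t := by
        intro s
        cases hs : h (vertex s) with
        | vertex t => exact ⟨t, rfl⟩
        | center =>
          have h1 := hmarg (vertex s) center
          have h2 : full (vertex s) center / N = 0 := by simp [full, row, ell]
          rw [h2] at h1
          have h3 := (Finset.sum_eq_zero_iff_of_nonneg (fun k _ => by
            split_ifs
            exacts [hM k, le_rfl])).1 h1 h (Finset.mem_univ h)
          rw [if_pos hs] at h3
          exact absurd h3 h0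
      choose ψ hψ using hval
      have hψm : Monotone ψ := by
        intro s t hst'
        have := hmono h h0 (vertex_le_vertex.2 hst')
        rw [hψ, hψ] at this
        exact vertex_le_vertex.1 this
      rw [Finset.sum_eq_single (⟨ψ, hψm⟩ : S →o S)]
      · have h4 : (h (vertex x) = vertex y) ↔ ψ x = y := by
          rw [hψ]
          exact ⟨fun e => by injection e, fun e => by rw [e]⟩
        by_cases h5 : ψ x = y
        · have h6 : (⟨ψ, hψm⟩ : S →o S) x = y := h5
          rw [if_pos h6, if_pos (show ∀ s, h (vertex s) = vertex ((⟨ψ, hψm⟩ : S →o S) s) from hψ),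
            if_pos (h4.2 h5)]
        · have h6 : ¬ (⟨ψ, hψm⟩ : S →o S) x = y := h5
          rw [if_neg h6, if_neg (h4.not.2 h5), mul_zero]
      · intro φ _ hφ
        have : ¬ ∀ s, h (vertex s) = vertex (φ s) := by
          intro hcon
          refine hφ (OrderHom.ext _ _ (funext fun s => ?_))
          have h5 := (hcon s).symm.trans (hψ s)
          injection h5
        simp [this]
      · simp
    simp_rw [e2]
    rw [← Finset.mul_sum, hmarg, mul_div_cancel₀ _ hNpos.ne']
    have : (vertex y : A.Extension) ≠ vertex x := fun e =>
      hxy (by injection e with e; exact e.symm)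
    simp [full, row, ell, this]

end BipartiteSub

/-! ### Stochastically monotone kernels that are not realizable -/

section Unrealizable

open scoped Classical

/-- The basic obstruction. The rows are constant on four classes, of which `a₁, a₂, b₁, b₂` are
representatives. In a realization the jumps `b₁ ↦ e`, `b₂ ↦ f` and `a₁ ↦ g` exclude each other,
and each of them forces `a₂` to jump to `e` or to `f`; but the former have total rate three and
the latter total rate two. -/
lemma hasUnrealizableRows_of_classes {S : Type*} [Fintype S] [PartialOrder S] (r : S → Bool × Bool)
    (hr : ∀ x y, x ≤ y → r x = r y ∨ ((r x).1 = false ∧ (r y).1 = true))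
    {a₁ a₂ b₁ b₂ e f g k k₁ k₂ : S} (ha₁ : r a₁ = (false, false)) (ha₂ : r a₂ = (false, true))
    (hb₁ : r b₁ = (true, false)) (hb₂ : r b₂ = (true, true))
    (h₁₁ : a₁ ≤ b₁) (h₁₂ : a₁ ≤ b₂) (h₂₁ : a₂ ≤ b₁) (h₂₂ : a₂ ≤ b₂)
    (heg : e ≤ g) (hfg : f ≤ g) (hef : ¬ e ≤ f) (hfe : ¬ f ≤ e)
    (hk₁ : k ≤ k₁) (hk₂ : k ≤ k₂) (hfk₁ : f ≤ k₁) (hek₂ : e ≤ k₂)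
    (hkg : ¬ k ≤ g) (hag : ¬ a₂ ≤ g) (hgk₁ : ¬ g ≤ k₁) (hgk₂ : ¬ g ≤ k₂)
    (hgb₁ : ¬ g ≤ b₁) (hgb₂ : ¬ g ≤ b₂) (ha₁g : a₁ ≠ g) : HasUnrealizableRows S := by
  let Q : Bool × Bool → Fin 3 → S := fun p =>
    match p with
    | (false, false) => ![e, f, g]
    | (false, true) => ![e, f, k]
    | (true, false) => ![e, g, k₁]
    | (true, true) => ![f, g, k₂]
  refine ⟨fun x => Q (r x), fun x y hxy => ?_, ?_⟩
  · rcases hr x y hxy with h | ⟨hx, hy⟩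
    · exact ⟨Equiv.refl _, fun i => (congrFun (congrArg Q h) i).le⟩
    · obtain ⟨x1, x2, hrx⟩ : ∃ p q, r x = (p, q) := ⟨_, _, rfl⟩
      obtain ⟨y1, y2, hry⟩ : ∃ p q, r y = (p, q) := ⟨_, _, rfl⟩
      rw [hrx] at hx
      rw [hry] at hy
      obtain rfl : x1 = false := hx
      obtain rfl : y1 = true := hy
      change ∃ σ : Equiv.Perm (Fin 3), ∀ i, Q (r x) i ≤ Q (r y) (σ i)
      rw [hrx, hry]
      cases x2 <;> cases y2
      · refine ⟨Equiv.swap 1 2, fun i => ?_⟩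
        fin_cases i
        exacts [le_refl e, hfk₁, le_refl g]
      · refine ⟨(finRotate 3).symm, fun i => ?_⟩
        fin_cases i
        exacts [hek₂, le_refl f, le_refl g]
      · refine ⟨Equiv.refl _, fun i => ?_⟩
        fin_cases i
        exacts [le_refl e, hfg, hk₁]
      · refine ⟨Equiv.swap 0 1, fun i => ?_⟩
        fin_cases i
        exacts [heg, le_refl f, hk₂]
  · rintro ⟨w, hw, hwq'⟩
    have hwq : ∀ x y, x ≠ y → ∑ h : S →o S, (if h x = y then w h else 0) =
        ∑ i, if Q (r x) i = y then (1 : ℝ) else 0 := hwq'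
    have hsupp : ∀ h : S →o S, w h ≠ 0 → ∀ x, h x = x ∨ ∃ i, Q (r x) i = h x := by
      intro h hh x
      by_contra! hcon
      have h1 := hwq x (h x) hcon.1.symm
      have h2 : ∑ i, (if Q (r x) i = h x then (1 : ℝ) else 0) = 0 :=
        Finset.sum_eq_zero fun i _ => if_neg (hcon.2 i)
      rw [h2] at h1
      have h3 := (Finset.sum_eq_zero_iff_of_nonneg (fun k _ => by
        split_ifs
        exacts [hw k, le_rfl])).1 h1 h (Finset.mem_univ h)
      rw [if_pos rfl] at h3
      exact hh h3
    have hke : ¬ k ≤ e := fun h => hkg (h.trans heg)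
    have hkf : ¬ k ≤ f := fun h => hkg (h.trans hfg)
    have hae : ¬ a₂ ≤ e := fun h => hag (h.trans heg)
    have haf : ¬ a₂ ≤ f := fun h => hag (h.trans hfg)
    have hge : ¬ g ≤ e := fun h => hfe (hfg.trans h)
    have hgf : ¬ g ≤ f := fun h => hef (heg.trans h)
    have hmaps : ∀ h : S →o S, w h ≠ 0 →
        (if h b₁ = e then w h else 0) + (if h b₂ = f then w h else 0) +
          (if h a₁ = g then w h else 0) ≤
        (if h a₂ = e then w h else 0) + if h a₂ = f then w h else 0 := by
      intro h hh
      have hwh := hw h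
      have hva₂ : h a₂ = a₂ ∨ h a₂ = e ∨ h a₂ = f ∨ h a₂ = k := by
        rcases hsupp h hh a₂ with h1 | ⟨i, hi⟩
        · exact Or.inl h1
        · rw [ha₂] at hi
          fin_cases i
          exacts [Or.inr (Or.inl hi.symm), Or.inr (Or.inr (Or.inl hi.symm)),
            Or.inr (Or.inr (Or.inr hi.symm))]
      have hvb₁ : h b₁ = b₁ ∨ h b₁ = e ∨ h b₁ = g ∨ h b₁ = k₁ := by
        rcases hsupp h hh b₁ with h1 | ⟨i, hi⟩
        · exact Or.inl h1
        · rw [hb₁] at hi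
          fin_cases i
          exacts [Or.inr (Or.inl hi.symm), Or.inr (Or.inr (Or.inl hi.symm)),
            Or.inr (Or.inr (Or.inr hi.symm))]
      have hvb₂ : h b₂ = b₂ ∨ h b₂ = f ∨ h b₂ = g ∨ h b₂ = k₂ := by
        rcases hsupp h hh b₂ with h1 | ⟨i, hi⟩
        · exact Or.inl h1
        · rw [hb₂] at hi
          fin_cases i
          exacts [Or.inr (Or.inl hi.symm), Or.inr (Or.inr (Or.inl hi.symm)),
            Or.inr (Or.inr (Or.inr hi.symm))]
      have m11 := h.monotone h₁₁
      have m12 := h.monotone h₁₂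
      have m21 := h.monotone h₂₁
      have m22 := h.monotone h₂₂
      have c1 : h b₁ = e → h a₂ = e := by
        intro hb
        rw [hb] at m21
        rcases hva₂ with h1 | h1 | h1 | h1
        · exact absurd (h1 ▸ m21) hae
        · exact h1
        · exact absurd (h1 ▸ m21) hfe
        · exact absurd (h1 ▸ m21) hke
      have c2 : h b₂ = f → h a₂ = f := by
        intro hb
        rw [hb] at m22
        rcases hva₂ with h1 | h1 | h1 | h1
        · exact absurd (h1 ▸ m22) haf
        · exact absurd (h1 ▸ m22) hef
        · exact h1
        · exact absurd (h1 ▸ m22) hkf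
      have c3 : h a₁ = g → h b₁ = g ∧ h b₂ = g ∧ (h a₂ = e ∨ h a₂ = f) := by
        intro ha
        rw [ha] at m11 m12
        have hb1 : h b₁ = g := by
          rcases hvb₁ with h1 | h1 | h1 | h1
          · exact absurd (h1 ▸ m11) hgb₁
          · exact absurd (h1 ▸ m11) hge
          · exact h1
          · exact absurd (h1 ▸ m11) hgk₁
        have hb2 : h b₂ = g := by
          rcases hvb₂ with h1 | h1 | h1 | h1
          · exact absurd (h1 ▸ m12) hgb₂
          · exact absurd (h1 ▸ m12) hgf
          · exact h1
          · exact absurd (h1 ▸ m12) hgk₂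
        refine ⟨hb1, hb2, ?_⟩
        rw [hb1] at m21
        rcases hva₂ with h1 | h1 | h1 | h1
        · exact absurd (h1 ▸ m21) hag
        · exact Or.inl h1
        · exact Or.inr h1
        · exact absurd (h1 ▸ m21) hkg
      have hne : e ≠ f := fun h => hef h.le
      have hneg : g ≠ e := fun h => hge h.le
      have hnfg : g ≠ f := fun h => hgf h.le
      by_cases p3 : h a₁ = g
      · obtain ⟨h1, h2, h3⟩ := c3 p3
        rw [if_pos p3, h1, h2, if_neg hneg, if_neg hnfg]
        rcases h3 with h3 | h3
        · rw [if_pos h3, h3, if_neg hne]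
          linarith
        · rw [if_pos h3, h3, if_neg hne.symm]
          linarith
      · rw [if_neg p3]
        by_cases p1 : h b₁ = e
        · have p2 : h b₂ ≠ f := fun h2 => hne ((c1 p1).symm.trans (c2 h2))
          rw [if_pos p1, if_neg p2, if_pos (c1 p1)]
          split_ifs <;> linarith
        · rw [if_neg p1]
          by_cases p2 : h b₂ = f
          · rw [if_pos p2, if_pos (c2 p2)]
            split_ifs <;> linarith
          · rw [if_neg p2]
            split_ifs <;> linarith
    have hsum : ∑ h : S →o S, ((if h b₁ = e then w h else 0) + (if h b₂ = f then w h else 0) +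
          (if h a₁ = g then w h else 0)) ≤
        ∑ h : S →o S, ((if h a₂ = e then w h else 0) + if h a₂ = f then w h else 0) := by
      refine Finset.sum_le_sum fun h _ => ?_
      by_cases hh : w h = 0
      · simp [hh]
      · exact hmaps h hh
    simp only [Finset.sum_add_distrib] at hsum
    have hbe : b₁ ≠ e := fun h => hag (h₂₁.trans (h.le.trans heg))
    have hbf : b₂ ≠ f := fun h => hag (h₂₂.trans (h.le.trans hfg))
    rw [hwq b₁ e hbe, hwq b₂ f hbf, hwq a₁ g ha₁g, hwq a₂ e fun h => hae h.le,
      hwq a₂ f fun h => haf h.le, ha₁, ha₂, hb₁, hb₂] at hsum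
    have hcount : ∀ p q s y : S, ∑ i, (if ![p, q, s] i = y then (1 : ℝ) else 0) =
        (if p = y then 1 else 0) + (if q = y then 1 else 0) + if s = y then 1 else 0 :=
      fun p q s y => Fin.sum_univ_three _
    have v₁ : ∑ i, (if Q (true, false) i = e then (1 : ℝ) else 0) = _ := hcount e g k₁ e
    have v₂ : ∑ i, (if Q (true, true) i = f then (1 : ℝ) else 0) = _ := hcount f g k₂ f
    have v₃ : ∑ i, (if Q (false, false) i = g then (1 : ℝ) else 0) = _ := hcount e f g g
    have v₄ : ∑ i, (if Q (false, true) i = e then (1 : ℝ) else 0) = _ := hcount e f k e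
    have v₅ : ∑ i, (if Q (false, true) i = f then (1 : ℝ) else 0) = _ := hcount e f k f
    rw [v₁, v₂, v₃, v₄, v₅, if_neg (show ¬ g = e from fun h => hge h.le),
      if_neg (show ¬ k₁ = e from fun h => hfe (hfk₁.trans h.le)),
      if_neg (show ¬ g = f from fun h => hgf h.le),
      if_neg (show ¬ k₂ = f from fun h => hef (hek₂.trans h.le)),
      if_neg (show ¬ e = g from fun h => hge h.ge), if_neg (show ¬ f = g from fun h => hgf h.ge),
      if_neg (show ¬ f = e from fun h => hfe h.le), if_neg (show ¬ e = f from fun h => hef h.le),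
      if_neg (show ¬ k = e from fun h => hke h.le), if_neg (show ¬ k = f from fun h => hkf h.le)]
      at hsum
    norm_num at hsum

end Unrealizable

/-! ### Reduced extensions -/

section Reduced

variable {S T : Type*} [PartialOrder S] [PartialOrder T]

/-- An extension of `S` is reduced if each of its new vertices has at least two lower and at
least two upper covers. -/
structure IsReducedExtension (ι : S ↪o T) : Prop where
  exists_bot : ∀ c, c ∉ Set.range ι → ∃ k k', k ⋖ c ∧ k' ⋖ c ∧ k ≠ k'
  exists_top : ∀ c, c ∉ Set.range ι → ∃ l l', c ⋖ l ∧ c ⋖ l' ∧ l ≠ l'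

namespace IsReducedExtension

variable {ι : S ↪o T}

lemma dual (h : IsReducedExtension ι) : IsReducedExtension ι.dual where
  exists_bot := fun c hc => by
    obtain ⟨l, l', hl, hl', hne⟩ := h.exists_top (OrderDual.ofDual c) hc
    exact ⟨_, _, hl.toDual, hl'.toDual, hne⟩
  exists_top := fun c hc => by
    obtain ⟨l, l', hl, hl', hne⟩ := h.exists_bot (OrderDual.ofDual c) hc
    exact ⟨_, _, hl.toDual, hl'.toDual, hne⟩

lemma exists_le [Finite T] (h : IsReducedExtension ι) (t : T) : ∃ s, ι s ≤ t := by
  obtain ⟨m, hm, hmin⟩ := (Set.toFinite {m | m ≤ t}).exists_minimal ⟨t, le_rfl⟩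
  by_cases hmr : m ∈ Set.range ι
  · obtain ⟨s, rfl⟩ := hmr
    exact ⟨s, hm⟩
  · obtain ⟨k, -, hk, -⟩ := h.exists_bot m hmr
    exact absurd (hmin (hk.le.trans hm) hk.le) hk.lt.not_ge

lemma exists_ge [Finite T] (h : IsReducedExtension ι) (t : T) : ∃ s, t ≤ ι s :=
  h.dual.exists_le (OrderDual.toDual t)

lemma preconnected [Finite T] (h : IsReducedExtension ι)
    (hS : (SimpleGraph.hasse S).Preconnected) : (SimpleGraph.hasse T).Preconnected := by
  refine preconnected_of_forall_isUncrossed fun W hW x hx y => ?_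
  obtain ⟨s, hs⟩ := h.exists_le x
  obtain ⟨t, ht⟩ := h.exists_le y
  have hU : IsUncrossed (ι ⁻¹' W) := fun a b hab =>
    hW.mem_iff_of_le (ι.le_iff_le.2 hab.le)
  exact (hW.mem_iff_of_le ht).1 (hU.mem_of_mem hS (x := s) ((hW.mem_iff_of_le hs).2 hx) t)

end IsReducedExtension

/-- A vertex with at most one lower cover can be deleted: the edges upwards from it become edges
from its lower cover, and the cuts persist. -/
lemma AcyclicPoset.delete_of_bot (hT : AcyclicPoset T) {c : T}
    (hc : ∀ p p', p ⋖ c → p' ⋖ c → p = p') : AcyclicPoset {x : T // x ≠ c} := by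
  have hcov : ∀ x y : {x : T // x ≠ c}, x ⋖ y → x.1 ⋖ y.1 ∨ (x.1 ⋖ c ∧ c ⋖ y.1) := by
    intro x y hxy
    by_cases h : x.1 ⋖ y.1
    · exact Or.inl h
    · obtain ⟨z, hz, hzy⟩ := exists_lt_lt_of_not_covBy (a := x.1) (b := y.1) hxy.lt h
      have hzc : z = c := by
        by_contra hne
        exact hxy.2 (c := ⟨z, hne⟩) hz hzy
      subst hzc
      exact Or.inr ⟨⟨hz, fun w hw hwz => hxy.2 (c := ⟨w, hwz.ne⟩) hw (hwz.trans hzy)⟩,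
        ⟨hzy, fun w hw hwy => hxy.2 (c := ⟨w, hw.ne'⟩) (hz.trans hw) hwy⟩⟩
  rw [acyclicPoset_iff_exists_isCut]
  intro u v huv
  rcases hcov u v huv with h | ⟨hu, hv⟩
  · obtain ⟨V, hV⟩ := hT.exists_isCut h
    refine ⟨Subtype.val ⁻¹' V, hV.bot_notMem, hV.top_mem, fun x y hxy hne => ?_⟩
    rcases hcov x y hxy with h' | ⟨hx, hy⟩
    · exact hV.mem_iff _ _ h' (by simpa [Subtype.ext_iff] using hne)
    · exact (hV.mem_iff _ _ hx (Or.inr v.2.symm)).trans (hV.mem_iff _ _ hy (Or.inl u.2.symm))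
  · obtain ⟨V, hV⟩ := hT.exists_isCut hv
    refine ⟨Subtype.val ⁻¹' V, (hV.mem_iff _ _ hu (Or.inl u.2)).not.2 hV.bot_notMem, hV.top_mem,
      fun x y hxy hne => ?_⟩
    rcases hcov x y hxy with h' | ⟨hx, hy⟩
    · exact hV.mem_iff _ _ h' (Or.inl x.2)
    · have hxu : x = u := Subtype.ext (hc _ _ hx hu)
      have hyv : y.1 ≠ v.1 := fun e => by
        rcases hne with h | h
        exacts [h hxu, h (Subtype.ext e)]
      exact (hV.mem_iff _ _ hx (Or.inl x.2)).trans (hV.mem_iff _ _ hy (Or.inr hyv))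

lemma AcyclicPoset.delete_of_top (hT : AcyclicPoset T) {c : T}
    (hc : ∀ p p', c ⋖ p → c ⋖ p' → p = p') : AcyclicPoset {x : T // x ≠ c} := by
  have h := (hT.dual.delete_of_bot (c := OrderDual.toDual c)
    fun p p' hp hp' => hc p p' hp.ofDual hp'.ofDual).dual
  refine h.of_orderIso ⟨⟨fun x => OrderDual.toDual ⟨OrderDual.toDual x.1, x.2⟩,
    fun x => ⟨OrderDual.ofDual (OrderDual.ofDual x).1, (OrderDual.ofDual x).2⟩,
    fun x => rfl, fun x => rfl⟩, Iff.rfl⟩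

end Reduced

/-- Among the acyclic extensions of `S`, one of least cardinality is reduced. -/
lemma HasAcyclicExtension.exists_isReducedExtension.{u} {S : Type u} [PartialOrder S]
    (h : HasAcyclicExtension S) : ∃ (T : Type u) (_ : PartialOrder T) (ι : S ↪o T),
      Finite T ∧ AcyclicPoset T ∧ IsReducedExtension ι := by
  obtain ⟨T, hPO, hfin, -, hac, ⟨ι⟩⟩ := h
  induction hn : Nat.card T using Nat.strong_induction_on generalizing T with
  | _ n ih =>
  subst hn
  by_cases hred : IsReducedExtension ι
  · exact ⟨T, hPO, ι, hfin, hac, hred⟩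
  obtain ⟨c, hc, hdel⟩ : ∃ c, c ∉ Set.range ι ∧ AcyclicPoset {x : T // x ≠ c} := by
    by_contra! hcon
    refine hred ⟨fun c hc => ?_, fun c hc => ?_⟩
    · by_contra! h
      exact hcon c hc (hac.delete_of_bot h)
    · by_contra! h
      exact hcon c hc (hac.delete_of_top h)
  refine ih (Nat.card {x : T // x ≠ c}) ?_ {x : T // x ≠ c} inferInstance inferInstance hdel
    ⟨⟨fun s => ⟨ι s, fun e => hc ⟨s, e⟩⟩, fun s t e => ι.injective (congrArg Subtype.val e)⟩,
      ι.le_iff_le⟩ rfl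
  exact Finite.card_subtype_lt (p := fun x => x ≠ c) (x := c) (by simp)

/-! ### Bowties in a branch -/

section Branch

variable {S T : Type*} [Fintype S] [PartialOrder S] [PartialOrder T] [Finite T] {ι : S ↪o T}
  {c : T}

/-- In a branch below a new vertex `c`, consider `e, f ≤ g` with `e`, `f` incomparable and
`g ≰ c`. If these form a bowtie with `c` or with another element `h` of `S`, then the basic
obstruction is present; its classes are read off from the branches at `c`. -/
lemma hasUnrealizableRows_of_branch (hac : AcyclicPoset T)
    (hι : IsReducedExtension ι) (hc : c ∉ Set.range ι)
    {k : T} {V : Set T} (hk : k ⋖ c) (hV : IsCut k c V) {e f g : S} (hg : ι g ∉ V)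
    (hef : ¬ e ≤ f) (hfe : ¬ f ≤ e) (heg : e ≤ g) (hfg : f ≤ g)
    (hgc : ¬ ι g ≤ c)
    (hcase : (ι e ≤ c ∧ ι f ≤ c) ∨
      ∃ h, e ≤ h ∧ f ≤ h ∧ ¬ g ≤ h ∧ ¬ h ≤ g) : HasUnrealizableRows S := by
  classical
  obtain ⟨k₁, k₂, hk₁, hk₂, hkne, hk₂k⟩ : ∃ k₁ k₂, k₁ ⋖ c ∧ k₂ ⋖ c ∧ k₁ ≠ k₂ ∧ k₂ ≠ k := by
    obtain ⟨k₁, k₂, hk₁, hk₂, hne⟩ := hι.exists_bot c hc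
    by_cases h : k₂ = k
    · exact ⟨k₂, k₁, hk₂, hk₁, hne.symm, fun e => hne (e.trans h.symm)⟩
    · exact ⟨k₁, k₂, hk₁, hk₂, hne, h⟩
  obtain ⟨l₁, l₂, hl₁, hl₂, hlne⟩ := hι.exists_top c hc
  obtain ⟨a₁, ha₁⟩ := hι.exists_le k₁
  obtain ⟨a₂, ha₂⟩ := hι.exists_le k₂
  obtain ⟨b₁, hb₁⟩ := hι.exists_ge l₁
  obtain ⟨b₂, hb₂⟩ := hι.exists_ge l₂
  obtain ⟨V₁, hV₁⟩ := hac.exists_isCut hk₁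
  obtain ⟨W₁, hW₁⟩ := hac.exists_isCut hl₁
  have ha₁c := ha₁.trans hk₁.le
  have ha₂c := ha₂.trans hk₂.le
  have hcb₁ := hl₁.le.trans hb₁
  have hcb₂ := hl₂.le.trans hb₂
  have hVup := hV.isUpperSet hk
  have hV₁up := hV₁.isUpperSet hk₁
  have hW₁up := hW₁.isUpperSet hl₁
  have hne : ∀ s, ι s ≠ c := fun s e => hc ⟨s, e⟩
  -- an element of the second lower branch lies on the upper side of each other lower edge
  have hmem : ∀ {k' : T} {V' : Set T}, k' ⋖ c → IsCut k' c V' → k₂ ≠ k' → ι a₂ ∈ V' := by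
    intro k' V' hk' hV' hne'
    by_contra h
    have h1 : k₂ ∈ V' := (hV'.mem_iff k₂ c hk₂ (Or.inl hne')).2 hV'.top_mem
    exact hk₂.lt.not_ge (hV'.le_of_notMem_of_mem ha₂ h h1).2
  have hup_of_le : ∀ {t : T}, t ≤ c → t ∉ upperBranches c := fun ht h =>
    notMem_upperBranches_self (isUpperSet_upperBranches ht h)
  have hgb : ∀ {b : S}, c ≤ ι b → ¬ g ≤ b := fun hb hgb =>
    hgc ((hV.le_of_notMem_of_mem (ι.le_iff_le.2 hgb) hg (hVup hb hV.top_mem)).1.trans hk.le)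
  have hag : ¬ a₂ ≤ g := fun h =>
    hg (hVup (ι.le_iff_le.2 h) (hmem hk hV hk₂k))
  -- the class of `a₁` is the lower branch at `k₁`, that of `b₁` the upper branch at `l₁`, that of
  -- `b₂` the rest of the upper branches, and that of `a₂` the rest of `S`
  let r : S → Bool × Bool := fun z =>
    if ι z ∉ V₁ then (false, false) else if ι z ∈ W₁ then (true, false) else
      if ι z ∈ upperBranches c then (true, true) else (false, true)
  have hr : ∀ x y, x ≤ y → r x = r y ∨ ((r x).1 = false ∧ (r y).1 = true) := by
    intro x y hxy
    have hxy' := ι.le_iff_le.2 hxy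
    by_cases hx : ι x ∈ V₁
    · have hy := hV₁up hxy' hx
      by_cases hxW : ι x ∈ W₁
      · have hyW := hW₁up hxy' hxW
        simp [r, hx, hy, hxW, hyW]
      · by_cases hxu : ι x ∈ upperBranches c
        · have hyu := isUpperSet_upperBranches hxy' hxu
          have hyW : ι y ∉ W₁ := fun h =>
            hup_of_le (hW₁.le_of_notMem_of_mem hxy' hxW h).1 hxu
          simp [r, hx, hy, hxW, hyW, hxu, hyu]
        · by_cases hyW : ι y ∈ W₁
          · simp [r, hx, hy, hxW, hyW, hxu]
          · by_cases hyu : ι y ∈ upperBranches c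
            · simp [r, hx, hy, hxW, hyW, hxu, hyu]
            · simp [r, hx, hy, hxW, hyW, hxu, hyu]
    · by_cases hy : ι y ∈ V₁
      · have hcy := (hV₁.le_of_notMem_of_mem hxy' hx hy).2
        have hyu := hac.mem_upperBranches_of_lt (lt_of_le_of_ne hcy (hne y).symm)
        by_cases hyW : ι y ∈ W₁
        · simp [r, hx, hy, hyW]
        · simp [r, hx, hy, hyW, hyu]
      · simp [r, hx, hy]
  have hra₁ : r a₁ = (false, false) := by
    have : ι a₁ ∉ V₁ := fun h => hV₁.bot_notMem (hV₁up ha₁ h)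
    simp [r, this]
  have hra₂ : r a₂ = (false, true) := by
    have h1 := hmem hk₁ hV₁ hkne.symm
    have h2 : ι a₂ ∉ W₁ := fun h => hW₁.bot_notMem (hW₁up ha₂c h)
    simp [r, h1, h2, hup_of_le ha₂c]
  have hrb₁ : r b₁ = (true, false) := by
    simp [r, hV₁up hcb₁ hV₁.top_mem, hW₁up hb₁ hW₁.top_mem]
  have hrb₂ : r b₂ = (true, true) := by
    have h1 : ι b₂ ∉ W₁ := fun h => hlne
      (hac.covBy_unique_top hl₁ hl₂ (hW₁.le_of_notMem_of_mem hcb₂ hW₁.bot_notMem h).2 hb₂)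
    simp [r, hV₁up hcb₂ hV₁.top_mem, h1,
      hac.mem_upperBranches_of_lt (lt_of_le_of_ne hcb₂ (hne b₂).symm)]
  have h₁₁ : a₁ ≤ b₁ := ι.le_iff_le.1 (ha₁c.trans hcb₁)
  have h₁₂ : a₁ ≤ b₂ := ι.le_iff_le.1 (ha₁c.trans hcb₂)
  have h₂₁ : a₂ ≤ b₁ := ι.le_iff_le.1 (ha₂c.trans hcb₁)
  have h₂₂ : a₂ ≤ b₂ := ι.le_iff_le.1 (ha₂c.trans hcb₂)
  have ha₁g : a₁ ≠ g := fun e => hgc (e ▸ ha₁c)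
  rcases hcase with ⟨hec, hfc⟩ | ⟨h, heh, hfh, hgh, hhg⟩
  · exact hasUnrealizableRows_of_classes r hr hra₁ hra₂ hrb₁ hrb₂ h₁₁ h₁₂ h₂₁ h₂₂ heg hfg hef hfe
      h₂₁ h₂₂ (ι.le_iff_le.1 (hfc.trans hcb₁)) (ι.le_iff_le.1 (hec.trans hcb₂)) hag hag
      (hgb hcb₁) (hgb hcb₂) (hgb hcb₁) (hgb hcb₂) ha₁g
  · exact hasUnrealizableRows_of_classes r hr hra₁ hra₂ hrb₁ hrb₂ h₁₁ h₁₂ h₂₁ h₂₂ heg hfg hef hfe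
      le_rfl le_rfl hfh heh hhg hag hgh hgh (hgb hcb₁) (hgb hcb₂) ha₁g

/-- If `c` is the only new vertex, then an induced bowtie among `c` and the branches below `c`
excludes monotonicity equivalence. -/
lemma hasUnrealizableRows_of_bowtie_lower (hac : AcyclicPoset T)
    (hι : IsReducedExtension ι) (hc : c ∉ Set.range ι)
    (hrange : ∀ t, t ≠ c → t ∈ Set.range ι)
    (hbow : HasInducedBowtie ↥(insert c (lowerBranches c))) : HasUnrealizableRows S := by
  obtain ⟨⟨e, he⟩, ⟨f, hf⟩, ⟨g, hg⟩, ⟨h, hh⟩, heg, heh, hfg, hfh, hef, hfe, hgh, hhg⟩ := hbow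
  replace heg : e < g := heg
  replace heh : e < h := heh
  replace hfg : f < g := hfg
  replace hfh : f < h := hfh
  replace hef : ¬ e ≤ f := hef
  replace hfe : ¬ f ≤ e := hfe
  replace hgh : ¬ g ≤ h := hgh
  replace hhg : ¬ h ≤ g := hhg
  have hnlt : ∀ t ∈ insert c (lowerBranches c), ¬ c < t := by
    rintro t (rfl | ht) hlt
    · exact lt_irrefl _ hlt
    · exact notMem_lowerBranches_self (isLowerSet_lowerBranches hlt.le ht)
  have hec : e ≠ c := fun e' => hnlt g hg (e' ▸ heg)
  have hfc : f ≠ c := fun e' => hnlt g hg (e' ▸ hfg)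
  obtain ⟨e', rfl⟩ := hrange e hec
  obtain ⟨f', rfl⟩ := hrange f hfc
  obtain ⟨k, V, hk, hV, heV⟩ := he.resolve_left hec
  have hstay : ∀ t, ι e' ≤ t → t ∈ insert c (lowerBranches c) → t ≠ c → t ∉ V := by
    intro t het ht htc htV
    exact hnlt t ht (lt_of_le_of_ne (hV.le_of_notMem_of_mem het heV htV).2 htc.symm)
  by_cases hgc : g ≤ c
  · have hhc : ¬ h ≤ c := fun hhc => by
      rcases hac.le_or_le heg.le heh.le hgc hhc with h1 | h1
      exacts [hgh h1, hhg h1]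
    have hhc' : h ≠ c := fun e' => hhc e'.le
    obtain ⟨h', rfl⟩ := hrange h hhc'
    exact hasUnrealizableRows_of_branch hac hι hc hk hV (hstay _ heh.le hh hhc')
      (ι.le_iff_le.not.1 hef) (ι.le_iff_le.not.1 hfe) (ι.le_iff_le.1 heh.le)
      (ι.le_iff_le.1 hfh.le) hhc (Or.inl ⟨heg.le.trans hgc, hfg.le.trans hgc⟩)
  · have hgc' : g ≠ c := fun e' => hgc e'.le
    obtain ⟨g', rfl⟩ := hrange g hgc'
    refine hasUnrealizableRows_of_branch hac hι hc hk hV (hstay _ heg.le hg hgc')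
      (ι.le_iff_le.not.1 hef) (ι.le_iff_le.not.1 hfe) (ι.le_iff_le.1 heg.le)
      (ι.le_iff_le.1 hfg.le) hgc ?_
    by_cases hhc : h = c
    · exact Or.inl ⟨heh.le.trans hhc.le, hfh.le.trans hhc.le⟩
    · obtain ⟨h', rfl⟩ := hrange h hhc
      exact Or.inr ⟨h', ι.le_iff_le.1 heh.le, ι.le_iff_le.1 hfh.le, ι.le_iff_le.not.1 hgh,
        ι.le_iff_le.not.1 hhg⟩

/-- A second new vertex in a branch below `c` excludes monotonicity equivalence. -/
lemma hasUnrealizableRows_of_mem_lowerBranches (hac : AcyclicPoset T)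
    (hι : IsReducedExtension ι) (hc : c ∉ Set.range ι)
    {d : T} (hd : d ∉ Set.range ι) (hdc : d ∈ lowerBranches c) : HasUnrealizableRows S := by
  obtain ⟨k, V, hk, hV, hdV⟩ := hdc
  have hVup := hV.isUpperSet hk
  have hcd : ¬ c ≤ d := fun h => hdV (hVup h hV.top_mem)
  obtain ⟨p₁, p₂, hp₁, hp₂, hpne⟩ := hι.exists_bot d hd
  obtain ⟨e, hep⟩ := hι.exists_le p₁
  obtain ⟨f, hfp⟩ := hι.exists_le p₂
  have hed := hep.trans hp₁.le
  have hfd := hfp.trans hp₂.le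
  have hef : ¬ e ≤ f := fun h =>
    hpne (hac.covBy_unique_bot hp₁ hp₂ hep ((ι.le_iff_le.2 h).trans hfp))
  have hfe : ¬ f ≤ e := fun h =>
    hpne (hac.covBy_unique_bot hp₁ hp₂ ((ι.le_iff_le.2 h).trans hep) hfp)
  have heV : ι e ∉ V := fun h => hdV (hVup hed h)
  by_cases hle : d ≤ c
  · obtain ⟨q, hq, hqc⟩ : ∃ q, d ⋖ q ∧ ¬ q ≤ c := by
      obtain ⟨q₁, q₂, hq₁, hq₂, hqne⟩ := hι.exists_top d hd
      by_contra! hcon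
      exact hqne (hac.covBy_unique_top hq₁ hq₂ (hcon q₁ hq₁) (hcon q₂ hq₂))
    obtain ⟨g, hqg⟩ := hι.exists_ge q
    have hdg := hq.le.trans hqg
    have hgV : ι g ∉ V := by
      intro h
      have hcg := (hV.le_of_notMem_of_mem hdg hdV h).2
      have hdc : d < c := lt_of_le_not_ge hle hcd
      rcases hac.le_or_le hq.le hle hqg hcg with h1 | h1
      · exact hqc h1
      · exact hq.2 hdc (lt_of_le_of_ne h1 fun e' => hqc e'.ge)
    exact hasUnrealizableRows_of_branch hac hι hc hk hV hgV hef hfe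
      (ι.le_iff_le.1 (hed.trans hdg)) (ι.le_iff_le.1 (hfd.trans hdg))
      (fun h => hqc (hqg.trans h)) (Or.inl ⟨hed.trans hle, hfd.trans hle⟩)
  · obtain ⟨q₁, q₂, hq₁, hq₂, hqne⟩ := hι.exists_top d hd
    obtain ⟨g, hqg⟩ := hι.exists_ge q₁
    obtain ⟨h, hqh⟩ := hι.exists_ge q₂
    have hdg := hq₁.le.trans hqg
    have hdh := hq₂.le.trans hqh
    have hgV : ι g ∉ V := fun h =>
      hle ((hV.le_of_notMem_of_mem hdg hdV h).1.trans hk.le)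
    exact hasUnrealizableRows_of_branch hac hι hc hk hV hgV hef hfe
      (ι.le_iff_le.1 (hed.trans hdg)) (ι.le_iff_le.1 (hfd.trans hdg))
      (fun h => hle (hdg.trans h))
      (Or.inr ⟨h, ι.le_iff_le.1 (hed.trans hdh),
        ι.le_iff_le.1 (hfd.trans hdh),
        fun h => hqne (hac.covBy_unique_top hq₁ hq₂ (hqg.trans (ι.le_iff_le.2 h)) hqh),
        fun h => hqne (hac.covBy_unique_top hq₁ hq₂ hqg (hqh.trans (ι.le_iff_le.2 h)))⟩)

lemma hasUnrealizableRows_of_bowtie_upper (hac : AcyclicPoset T)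
    (hι : IsReducedExtension ι) (hc : c ∉ Set.range ι)
    (hrange : ∀ t, t ≠ c → t ∈ Set.range ι)
    (hbow : HasInducedBowtie ↥(insert c (upperBranches c))) : HasUnrealizableRows S := by
  obtain ⟨e, f, g, h, heg, heh, hfg, hfh, hef, hfe, hgh, hhg⟩ := hbow
  have hmem : ∀ t ∈ insert c (upperBranches c), OrderDual.toDual t ∈
      insert (OrderDual.toDual c) (lowerBranches (OrderDual.toDual c)) := by
    rintro t (rfl | ht)
    exacts [Or.inl rfl, Or.inr (toDual_mem_lowerBranches ht)]
  exact (hasUnrealizableRows_of_bowtie_lower hac.dual hι.dual hc hrange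
    ⟨⟨_, hmem _ g.2⟩, ⟨_, hmem _ h.2⟩, ⟨_, hmem _ e.2⟩, ⟨_, hmem _ f.2⟩, heg, hfg, heh, hfh,
      hhg, hgh, hfe, hef⟩).of_orderDual

/-- Two new vertices of a reduced acyclic extension exclude monotonicity equivalence. -/
lemma hasUnrealizableRows_of_ne (hac : AcyclicPoset T)
    (hT : (SimpleGraph.hasse T).Preconnected) (hι : IsReducedExtension ι) (hc : c ∉ Set.range ι)
    {d : T} (hd : d ∉ Set.range ι) (hdc : d ≠ c) : HasUnrealizableRows S := by
  rcases hac.mem_branches (c := c) hT d with h | h | h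
  · exact absurd h hdc
  · exact hasUnrealizableRows_of_mem_lowerBranches hac hι hc hd h
  · exact (hasUnrealizableRows_of_mem_lowerBranches hac.dual hι.dual hc
      (d := OrderDual.toDual d) hd (toDual_mem_lowerBranches h)).of_orderDual

end Branch

/-! ### The bipartite subgraph at a new vertex -/

section Middle

variable {S T : Type*} [PartialOrder S] [PartialOrder T] [Finite T]

/-- An element below elements of two different branches above `c` lies below `c`. -/
lemma AcyclicPoset.le_of_le_of_branches (hac : AcyclicPoset T) {c l₁ l₂ y₁ y₂ x : T}
    (hl₁ : c ⋖ l₁) (hl₂ : c ⋖ l₂) (hne : l₁ ≠ l₂) (h₁ : l₁ ≤ y₁) (h₂ : l₂ ≤ y₂)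
    (hx₁ : x ≤ y₁) (hx₂ : x ≤ y₂) : x ≤ c := by
  have hy : ¬ y₁ ≤ y₂ := fun h => hne (hac.covBy_unique_top hl₁ hl₂ (h₁.trans h) h₂)
  obtain ⟨m, hxm, hcm, hm₁, hm₂⟩ :=
    hac.exists_between hx₁ hx₂ (hl₁.le.trans h₁) (hl₂.le.trans h₂) hy
  by_cases h : c = m
  · exact h ▸ hxm
  · obtain ⟨l, hl, hlm⟩ := exists_covBy_top_le (lt_of_le_of_ne hcm h)
    exact absurd ((hac.covBy_unique_top hl₁ hl h₁ (hlm.trans hm₁)).trans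
      (hac.covBy_unique_top hl hl₂ (hlm.trans hm₂) h₂)) hne

lemma AcyclicPoset.le_of_branches_le (hac : AcyclicPoset T) {c k₁ k₂ y₁ y₂ x : T}
    (hk₁ : k₁ ⋖ c) (hk₂ : k₂ ⋖ c) (hne : k₁ ≠ k₂) (h₁ : y₁ ≤ k₁) (h₂ : y₂ ≤ k₂)
    (hx₁ : y₁ ≤ x) (hx₂ : y₂ ≤ x) : c ≤ x :=
  hac.dual.le_of_le_of_branches (c := OrderDual.toDual c) (x := OrderDual.toDual x)
    hk₁.toDual hk₂.toDual hne h₁ h₂ hx₁ hx₂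

variable {ι : S ↪o T} {c : T}

lemma exists_maximal_lt_le (hac : AcyclicPoset T) (hι : IsReducedExtension ι) {k : T}
    (hk : k ⋖ c) : ∃ a, Maximal (fun s => ι s < c) a ∧ ι a ≤ k := by
  have hfin : Finite S := Finite.of_injective ι ι.injective
  obtain ⟨s, hs⟩ := hι.exists_le k
  obtain ⟨a, hsa, ha⟩ := (Set.toFinite {s | ι s < c}).exists_le_maximal
    (show ι s < c from hs.trans_lt hk.lt)
  refine ⟨a, ha, ?_⟩
  rcases hac.le_or_le (ι.le_iff_le.2 hsa) hs ha.1.le hk.le with h | h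
  · exact h
  · exact (eq_of_le_of_not_lt h fun hlt => hk.2 hlt ha.1).ge

lemma exists_minimal_gt_ge (hac : AcyclicPoset T) (hι : IsReducedExtension ι) {l : T}
    (hl : c ⋖ l) : ∃ b, Minimal (fun s => c < ι s) b ∧ l ≤ ι b :=
  exists_maximal_lt_le hac.dual hι.dual (c := OrderDual.toDual c) hl.toDual

/-- The bipartite subgraph at a new vertex `c` of a reduced acyclic extension of `S`: its lower
vertices are the maximal elements of `S` below `c`, and its upper vertices the minimal elements of
`S` above `c`. -/
def bipartiteSubAt (hac : AcyclicPoset T) (hι : IsReducedExtension ι) (hc : c ∉ Set.range ι) :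
    BipartiteSub S where
  lower := {a | Maximal (fun s => ι s < c) a}
  upper := {b | Minimal (fun s => c < ι s) b}
  lower_nontrivial := by
    obtain ⟨k₁, k₂, hk₁, hk₂, hne⟩ := hι.exists_bot c hc
    obtain ⟨a₁, ha₁, ha₁k⟩ := exists_maximal_lt_le hac hι hk₁
    obtain ⟨a₂, ha₂, ha₂k⟩ := exists_maximal_lt_le hac hι hk₂
    exact ⟨a₁, ha₁, a₂, ha₂, fun e => hne (hac.covBy_unique_bot hk₁ hk₂ ha₁k (e ▸ ha₂k))⟩
  upper_nontrivial := by
    obtain ⟨l₁, l₂, hl₁, hl₂, hne⟩ := hι.exists_top c hc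
    obtain ⟨b₁, hb₁, hb₁l⟩ := exists_minimal_gt_ge hac hι hl₁
    obtain ⟨b₂, hb₂, hb₂l⟩ := exists_minimal_gt_ge hac hι hl₂
    exact ⟨b₁, hb₁, b₂, hb₂, fun e => hne (hac.covBy_unique_top hl₁ hl₂ hb₁l (e ▸ hb₂l))⟩
  covBy := by
    intro a ha b hb
    refine ⟨ι.lt_iff_lt.1 (ha.1.trans hb.1), fun s has hsb => ?_⟩
    rcases hac.le_or_le (ι.lt_iff_lt.2 has).le ha.1.le (ι.lt_iff_lt.2 hsb).le hb.1.le with h | h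
    · exact (ha.2 (lt_of_le_of_ne h fun e => hc ⟨s, e⟩) has.le).not_gt has
    · exact (hb.2 (lt_of_le_of_ne h fun e => hc ⟨s, e.symm⟩) hsb.le).not_gt hsb

variable (hac : AcyclicPoset T) (hι : IsReducedExtension ι) (hc : c ∉ Set.range ι)

lemma isMaximal_bipartiteSubAt : (bipartiteSubAt hac hι hc).IsMaximal := by
  obtain ⟨l₁, l₂, hl₁, hl₂, hlne⟩ := hι.exists_top c hc
  obtain ⟨b₁, hb₁, hb₁l⟩ := exists_minimal_gt_ge hac hι hl₁
  obtain ⟨b₂, hb₂, hb₂l⟩ := exists_minimal_gt_ge hac hι hl₂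
  obtain ⟨k₁, k₂, hk₁, hk₂, hkne⟩ := hι.exists_bot c hc
  obtain ⟨a₁, ha₁, ha₁k⟩ := exists_maximal_lt_le hac hι hk₁
  obtain ⟨a₂, ha₂, ha₂k⟩ := exists_maximal_lt_le hac hι hk₂
  intro B hlow hupp
  refine BipartiteSub.ext (Set.Subset.antisymm (fun a ha => ?_) hlow)
    (Set.Subset.antisymm (fun b hb => ?_) hupp)
  · have h₁ := B.covBy a ha b₁ (hupp hb₁)
    have h₂ := B.covBy a ha b₂ (hupp hb₂)
    have hle := hac.le_of_le_of_branches hl₁ hl₂ hlne hb₁l hb₂l (ι.le_iff_le.2 h₁.le)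
      (ι.le_iff_le.2 h₂.le)
    refine ⟨lt_of_le_of_ne hle fun e => hc ⟨a, e⟩, fun s hs has => ?_⟩
    exact (eq_of_le_of_not_lt has fun hlt => h₁.2 hlt (ι.lt_iff_lt.1 (hs.trans hb₁.1))).ge
  · have h₁ := B.covBy a₁ (hlow ha₁) b hb
    have h₂ := B.covBy a₂ (hlow ha₂) b hb
    have hle := hac.le_of_branches_le hk₁ hk₂ hkne ha₁k ha₂k (ι.le_iff_le.2 h₁.le)
      (ι.le_iff_le.2 h₂.le)
    refine ⟨lt_of_le_of_ne hle fun e => hc ⟨b, e.symm⟩, fun s hs hsb => ?_⟩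
    exact (eq_of_le_of_not_lt hsb fun hlt => h₁.2 (ι.lt_iff_lt.1 (ha₁.1.trans hs)) hlt).ge

/-- The bipartite subgraph at a new vertex determines the vertex. -/
lemma bipartiteSubAt_injective {d : T} (hd : d ∉ Set.range ι)
    (h : bipartiteSubAt hac hι hc = bipartiteSubAt hac hι hd) : c = d := by
  obtain ⟨l₁, l₂, hl₁, hl₂, hlne⟩ := hι.exists_top c hc
  obtain ⟨b₁, hb₁, hb₁l⟩ := exists_minimal_gt_ge hac hι hl₁
  obtain ⟨b₂, hb₂, hb₂l⟩ := exists_minimal_gt_ge hac hι hl₂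
  obtain ⟨k₁, k₂, hk₁, hk₂, hkne⟩ := hι.exists_bot c hc
  obtain ⟨a₁, ha₁, ha₁k⟩ := exists_maximal_lt_le hac hι hk₁
  obtain ⟨a₂, ha₂, ha₂k⟩ := exists_maximal_lt_le hac hι hk₂
  have hlow : ∀ a, Maximal (fun s => ι s < c) a → ι a < d := fun a ha =>
    (show a ∈ (bipartiteSubAt hac hι hd).lower from h ▸ ha).1
  have hupp : ∀ b, Minimal (fun s => c < ι s) b → d < ι b := fun b hb =>
    (show b ∈ (bipartiteSubAt hac hι hd).upper from h ▸ hb).1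
  exact le_antisymm
    (hac.le_of_branches_le hk₁ hk₂ hkne ha₁k ha₂k (hlow a₁ ha₁).le (hlow a₂ ha₂).le)
    (hac.le_of_le_of_branches hl₁ hl₂ hlne hb₁l hb₂l (hupp b₁ hb₁).le (hupp b₂ hb₂).le)

/-- If `c` is the only new vertex, then each bipartite subgraph is contained in the one at `c`,
because an element in the middle of it, which `exists_between` provides in the extension, can only
be `c`. -/
lemma BipartiteSub.eq_bipartiteSubAt (hrange : ∀ t, t ≠ c → t ∈ Set.range ι)
    {B : BipartiteSub S} (hB : B.IsMaximal) : B = bipartiteSubAt hac hι hc := by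
  have key : ∀ a ∈ B.lower, ∀ b ∈ B.upper, ι a < c ∧ c < ι b := by
    intro a ha b hb
    obtain ⟨a', ha', hane⟩ := B.lower_nontrivial.exists_ne a
    obtain ⟨b', hb', hbne⟩ := B.upper_nontrivial.exists_ne b
    obtain ⟨m, ham, ha'm, hmb, hmb'⟩ := hac.exists_between
      (ι.le_iff_le.2 (B.covBy a ha b hb).le) (ι.le_iff_le.2 (B.covBy a ha b' hb').le)
      (ι.le_iff_le.2 (B.covBy a' ha' b hb).le) (ι.le_iff_le.2 (B.covBy a' ha' b' hb').le)
      fun h => hbne (BipartiteSub.eq_of_le_of_mem_upper hb hb' (ι.le_iff_le.1 h)).symm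
    have hmc : m = c := by
      by_contra hmc
      obtain ⟨s, rfl⟩ := hrange m hmc
      rw [ι.le_iff_le] at ham ha'm hmb hmb'
      rcases (B.covBy a ha b hb).eq_or_eq ham hmb with e | e
      · exact hane (BipartiteSub.eq_of_le_of_mem_lower ha' ha (e ▸ ha'm))
      · exact hbne (BipartiteSub.eq_of_le_of_mem_upper hb hb' (e ▸ hmb')).symm
    rw [hmc] at ham hmb
    exact ⟨lt_of_le_of_ne ham fun e => hc ⟨a, e⟩, lt_of_le_of_ne hmb fun e => hc ⟨b, e.symm⟩⟩
  obtain ⟨a₀, ha₀⟩ := B.lower_nontrivial.nonempty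
  obtain ⟨b₀, hb₀⟩ := B.upper_nontrivial.nonempty
  refine (hB (bipartiteSubAt hac hι hc) (fun a ha => ⟨(key a ha b₀ hb₀).1, fun s hs has => ?_⟩)
    (fun b hb => ⟨(key a₀ ha₀ b hb).2, fun s hs hsb => ?_⟩)).symm
  · exact (eq_of_le_of_not_lt has fun hlt => (B.covBy a ha b₀ hb₀).2 hlt
      (ι.lt_iff_lt.1 (hs.trans (key a ha b₀ hb₀).2))).ge
  · exact (eq_of_le_of_not_lt hsb fun hlt => (B.covBy a₀ ha₀ b hb).2
      (ι.lt_iff_lt.1 ((key a₀ ha₀ b hb).1.trans hs)) hlt).ge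

open BipartiteSub.Extension in
/-- A reduced acyclic extension by one vertex is the extension at its bipartite subgraph. -/
lemma nonempty_extension_orderIso (hrange : ∀ t, t ≠ c → t ∈ Set.range ι) :
    Nonempty ((bipartiteSubAt hac hι hc).Extension ≃o T) := by
  have hfin : Finite S := Finite.of_injective ι ι.injective
  let F : (bipartiteSubAt hac hι hc).Extension → T := fun z =>
    match z with
    | center => c
    | vertex s => ι s
  have hF : ∀ x y, F x ≤ F y ↔ x ≤ y := by
    intro x y
    cases x with
    | center =>
      cases y with
      | center => exact iff_of_true le_rfl le_rfl
      | vertex t =>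
        rw [BipartiteSub.center_le_vertex]
        change c ≤ ι t ↔ _
        constructor
        · intro h
          obtain ⟨b, hbt, hb⟩ := (Set.toFinite {s | c < ι s}).exists_le_minimal
            (show c < ι t from lt_of_le_of_ne h fun e => hc ⟨t, e.symm⟩)
          exact ⟨b, hb, hbt⟩
        · rintro ⟨b, hb, hbt⟩
          exact hb.1.le.trans (ι.le_iff_le.2 hbt)
    | vertex s =>
      cases y with
      | center =>
        rw [BipartiteSub.vertex_le_center]
        change ι s ≤ c ↔ _
        constructor
        · intro h
          obtain ⟨a, hsa, ha⟩ := (Set.toFinite {s | ι s < c}).exists_le_maximal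
            (show ι s < c from lt_of_le_of_ne h fun e => hc ⟨s, e⟩)
          exact ⟨a, ha, hsa⟩
        · rintro ⟨a, ha, hsa⟩
          exact (ι.le_iff_le.2 hsa).trans ha.1.le
      | vertex t => exact ι.le_iff_le
  refine ⟨RelIso.ofSurjective (OrderEmbedding.ofMapLEIff F hF) fun t => ?_⟩
  by_cases htc : t = c
  · exact ⟨center, htc.symm⟩
  · obtain ⟨s, hs⟩ := hrange t htc
    exact ⟨vertex s, hs⟩

end Middle

/-! ### The two pieces of the extension -/

/-- A branch `K` at `c`, attached to `c` through the edge between `n` and `c`, consists of the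
vertices joined to `n` by a walk that avoids `c`. -/
lemma mem_iff_exists_walk {T : Type*} [PartialOrder T]
    (hT : (SimpleGraph.hasse T).Preconnected) {c n : T} {K : Set T} (hn : n ∈ K) (hc : c ∉ K)
    (hK : ∀ x y, (SimpleGraph.hasse T).Adj x y → x ∈ K → y ∉ K → x = n ∧ y = c) (z : T) :
    z ∈ K ↔ ∃ w : (SimpleGraph.hasse T).Walk z n, c ∉ w.support := by
  constructor
  · intro hz
    by_contra hw
    have hadj : ∀ x y, (SimpleGraph.hasse T).Adj x y →
        (x ∈ K ∧ ¬ ∃ w : (SimpleGraph.hasse T).Walk x n, c ∉ w.support) →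
        y ∈ K ∧ ¬ ∃ w : (SimpleGraph.hasse T).Walk y n, c ∉ w.support := by
      rintro x y hxy ⟨hx, hxw⟩
      have hcx : c ≠ x := fun e => hc (e ▸ hx)
      have hy : y ∈ K := by
        by_contra hy
        obtain ⟨rfl, -⟩ := hK x y hxy hx hy
        exact hxw ⟨SimpleGraph.Walk.nil, by simpa using hcx⟩
      refine ⟨hy, fun ⟨w, hw⟩ => hxw ⟨SimpleGraph.Walk.cons hxy w, ?_⟩⟩
      simp [hcx, hw]
    have hW : IsUncrossed {x | x ∈ K ∧ ¬ ∃ w : (SimpleGraph.hasse T).Walk x n, c ∉ w.support} :=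
      fun x y hxy => ⟨hadj x y (Or.inl hxy), hadj y x (Or.inr hxy)⟩
    exact hc (hW.mem_of_mem hT (x := z) ⟨hz, hw⟩ c).1
  · rintro ⟨w, hw⟩
    induction w with
    | nil => exact hn
    | @cons x y _ hadj w ih =>
      rw [SimpleGraph.Walk.support_cons, List.mem_cons, not_or] at hw
      by_contra hx
      exact hw.1 (hK y x hadj.symm (ih hn hK hw.2) hx).2.symm

namespace BipartiteSub

open Extension

variable {S : Type*} [PartialOrder S] {A : BipartiteSub S}

lemma vertex_covBy_center {a : S} : (vertex a : A.Extension) ⋖ center ↔ a ∈ A.lower := by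
  constructor
  · intro h
    obtain ⟨a', ha', haa'⟩ := vertex_lt_center.1 h.lt
    rcases haa'.eq_or_lt with e | hlt
    · exact e ▸ ha'
    · exact absurd (vertex_lt_center.2 ⟨a', ha', le_rfl⟩) (h.2 (vertex_lt_vertex.2 hlt))
  · intro ha
    refine ⟨vertex_lt_center.2 ⟨a, ha, le_rfl⟩, fun z hz hzc => ?_⟩
    cases z with
    | center => exact lt_irrefl _ hzc
    | vertex s =>
      obtain ⟨a', ha', hsa'⟩ := vertex_lt_center.1 hzc
      have hlt := (vertex_lt_vertex.1 hz).trans_le hsa'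
      exact hlt.ne (eq_of_le_of_mem_lower ha ha' hlt.le)

lemma center_covBy_vertex {b : S} : (center : A.Extension) ⋖ vertex b ↔ b ∈ A.upper := by
  constructor
  · intro h
    obtain ⟨b', hb', hbb'⟩ := center_lt_vertex.1 h.lt
    rcases hbb'.eq_or_lt with e | hlt
    · exact e ▸ hb'
    · exact absurd (vertex_lt_vertex.2 hlt) (h.2 (center_lt_vertex.2 ⟨b', hb', le_rfl⟩))
  · intro hb
    refine ⟨center_lt_vertex.2 ⟨b, hb, le_rfl⟩, fun z hz hzc => ?_⟩
    cases z with
    | center => exact lt_irrefl _ hz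
    | vertex s =>
      obtain ⟨b', hb', hsb'⟩ := center_lt_vertex.1 hz
      have hlt := hsb'.trans_lt (vertex_lt_vertex.1 hzc)
      exact hlt.ne (eq_of_le_of_mem_upper hb' hb hlt.le)

/-- The inclusion of `S` into the extension. -/
def vertexEmbedding (A : BipartiteSub S) : S ↪o A.Extension where
  toFun := vertex
  inj' := fun _ _ h => by injection h
  map_rel_iff' := Iff.rfl

lemma center_notMem_range : (center : A.Extension) ∉ Set.range A.vertexEmbedding := by
  rintro ⟨s, hs⟩
  exact absurd (show (vertex s : A.Extension) = center from hs) (by simp)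

lemma mem_range_of_ne_center (t : A.Extension) (ht : t ≠ center) :
    t ∈ Set.range A.vertexEmbedding := by
  cases t with
  | center => exact absurd rfl ht
  | vertex s => exact ⟨s, rfl⟩

lemma isReducedExtension_vertexEmbedding : IsReducedExtension A.vertexEmbedding where
  exists_bot := fun c hc => by
    obtain rfl : c = center := by_contra fun h => hc (mem_range_of_ne_center c h)
    obtain ⟨a, ha, a', ha', hne⟩ := A.lower_nontrivial
    exact ⟨vertex a, vertex a', vertex_covBy_center.2 ha, vertex_covBy_center.2 ha',
      fun e => hne (by injection e)⟩
  exists_top := fun c hc => by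
    obtain rfl : c = center := by_contra fun h => hc (mem_range_of_ne_center c h)
    obtain ⟨a, ha, a', ha', hne⟩ := A.upper_nontrivial
    exact ⟨vertex a, vertex a', center_covBy_vertex.2 ha, center_covBy_vertex.2 ha',
      fun e => hne (by injection e)⟩

lemma lowerPiece_eq (hac : AcyclicPoset A.Extension)
    (hT : (SimpleGraph.hasse A.Extension).Preconnected) :
    A.lowerPiece = insert center (lowerBranches center) := by
  have key : ∀ {a : S} {V : Set A.Extension}, (vertex a : A.Extension) ⋖ center →
      IsCut (vertex a) center V → ∀ v, v ∉ V ↔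
        ∃ w : (SimpleGraph.hasse A.Extension).Walk v (vertex a), center ∉ w.support := by
    intro a V ha hV v
    refine mem_iff_exists_walk hT (K := Vᶜ) hV.bot_notMem (fun h => h hV.top_mem) ?_ v
    rintro x y (hxy | hxy) hx hy
    · by_contra hne
      exact hy ((hV.mem_iff x y hxy (by tauto)).not.1 hx)
    · have hyV : y ∈ V := not_not.1 hy
      exact absurd ((hV.mem_iff y x hxy (Or.inl fun e => hV.bot_notMem (e ▸ hyV))).1 hyV) hx
  ext v
  refine or_congr_right ⟨?_, ?_⟩
  · rintro ⟨a, ha, hw⟩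
    have hcov := vertex_covBy_center.2 ha
    obtain ⟨V, hV⟩ := hac.exists_isCut hcov
    exact ⟨_, V, hcov, hV, (key hcov hV v).2 hw⟩
  · rintro ⟨k, V, hk, hV, hv⟩
    cases k with
    | center => exact absurd hk.lt (lt_irrefl _)
    | vertex a => exact ⟨a, vertex_covBy_center.1 hk, (key hk hV v).1 hv⟩

lemma upperPiece_eq (hac : AcyclicPoset A.Extension)
    (hT : (SimpleGraph.hasse A.Extension).Preconnected) :
    A.upperPiece = insert center (upperBranches center) := by
  have key : ∀ {b : S} {V : Set A.Extension}, (center : A.Extension) ⋖ vertex b →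
      IsCut center (vertex b) V → ∀ v, v ∈ V ↔
        ∃ w : (SimpleGraph.hasse A.Extension).Walk v (vertex b), center ∉ w.support := by
    intro b V hb hV v
    refine mem_iff_exists_walk hT hV.top_mem hV.bot_notMem ?_ v
    rintro x y (hxy | hxy) hx hy
    · exact absurd ((hV.mem_iff x y hxy (Or.inl fun e => hV.bot_notMem (e ▸ hx))).1 hx) hy
    · by_contra hne
      exact hy ((hV.mem_iff y x hxy (by tauto)).2 hx)
  ext v
  refine or_congr_right ⟨?_, ?_⟩
  · rintro ⟨b, hb, hw⟩
    have hcov := center_covBy_vertex.2 hb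
    obtain ⟨V, hV⟩ := hac.exists_isCut hcov
    exact ⟨_, V, hcov, hV, (key hcov hV v).2 hw⟩
  · rintro ⟨l, V, hl, hV, hv⟩
    cases l with
    | center => exact absurd hl.lt (lt_irrefl _)
    | vertex b => exact ⟨b, center_covBy_vertex.1 hl, (key hl hV v).1 hv⟩

end BipartiteSub

/-! ### The characterization -/

section Classification

variable {T : Type*} [PartialOrder T] [Finite T]

lemma AcyclicPoset.insert_lowerBranches (hac : AcyclicPoset T) (c : T) :
    AcyclicPoset ↥(insert c (lowerBranches c)) := by
  refine hac.subtype fun x _ y hy z _ hzy => Or.inr ?_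
  rcases hy with rfl | hy
  · exact hac.mem_lowerBranches_of_lt hzy
  · exact isLowerSet_lowerBranches hzy.le hy

lemma AcyclicPoset.insert_upperBranches (hac : AcyclicPoset T) (c : T) :
    AcyclicPoset ↥(insert c (upperBranches c)) := by
  refine hac.subtype fun x hx y _ z hxz _ => Or.inr ?_
  rcases hx with rfl | hx
  · exact hac.mem_upperBranches_of_lt hxz
  · exact isUpperSet_upperBranches hxz.le hx

end Classification

/-- An extension of a non-acyclic poset by an acyclic one has a new vertex. -/
lemma exists_notMem_range {S T : Type*} [PartialOrder S] [PartialOrder T]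
    (hcyc : ¬ AcyclicPoset S) (hac : AcyclicPoset T) (ι : S ↪o T) : ∃ c, c ∉ Set.range ι := by
  by_contra! h
  exact hcyc (hac.of_orderIso (RelIso.ofSurjective ι h))

open BipartiteSub BipartiteSub.Extension in
theorem proposition2p3 {S : Type*} [Fintype S] [PartialOrder S]
    (hconn : (SimpleGraph.hasse S).Connected) (hcyc : ¬ AcyclicPoset S)
    (hext : HasAcyclicExtension S) :
    MonotonicityEquivalence S ↔ IsYGluedBipartite S := by
  obtain ⟨T, _, ι, _, hac, hι⟩ := hext.exists_isReducedExtension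
  obtain ⟨c, hc⟩ := exists_notMem_range hcyc hac ι
  have hpre : ∀ A : BipartiteSub S, (SimpleGraph.hasse A.Extension).Preconnected := fun _ =>
    isReducedExtension_vertexEmbedding.preconnected hconn.preconnected
  constructor
  · intro hME
    have hno : ¬ HasUnrealizableRows S := fun h => h.not_monotonicityEquivalence hME
    have hrange : ∀ t, t ≠ c → t ∈ Set.range ι := fun t htc => by_contra fun ht =>
      hno (hasUnrealizableRows_of_ne hac (hι.preconnected hconn.preconnected) hι hc ht htc)
    obtain ⟨f⟩ := nonempty_extension_orderIso hac hι hc hrange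
    have hacE := hac.of_orderIso f
    refine ⟨hcyc, hext, bipartiteSubAt hac hι hc, isMaximal_bipartiteSubAt hac hι hc,
      fun B hB => eq_bipartiteSubAt hac hι hc hrange hB, ?_, ?_⟩
    · rw [lowerPiece_eq hacE (hpre _)]
      exact ⟨hacE.insert_lowerBranches _, fun h => hno (hasUnrealizableRows_of_bowtie_lower hacE
        isReducedExtension_vertexEmbedding center_notMem_range mem_range_of_ne_center h)⟩
    · rw [upperPiece_eq hacE (hpre _)]
      exact ⟨hacE.insert_upperBranches _, fun h => hno (hasUnrealizableRows_of_bowtie_upper hacE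
        isReducedExtension_vertexEmbedding center_notMem_range mem_range_of_ne_center h)⟩
  · rintro ⟨-, -, A, -, huniq, ⟨-, hlow⟩, ⟨-, hupp⟩⟩
    have hA : ∀ d (hd : d ∉ Set.range ι), bipartiteSubAt hac hι hd = A := fun d hd =>
      huniq _ (isMaximal_bipartiteSubAt hac hι hd)
    have hrange : ∀ t, t ≠ c → t ∈ Set.range ι := fun t htc => by_contra fun ht =>
      htc (bipartiteSubAt_injective hac hι ht hc ((hA t ht).trans (hA c hc).symm))
    obtain ⟨f⟩ := nonempty_extension_orderIso hac hι hc hrange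
    rw [hA c hc] at f
    have hacE := hac.of_orderIso f
    rw [lowerPiece_eq hacE (hpre _)] at hlow
    rw [upperPiece_eq hacE (hpre _)] at hupp
    exact fun L hL => ⟨fun hst => RateRealizable.realizablyMonotone hL
      (rateRealizable_of_extension hacE (hpre _) hlow hupp hL hst),
      fun h => h.stochasticallyMonotone⟩
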